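/- **Setting.** A *metric graph* is a metric space $Y$ obtained from finitely many vertices and finitely many edges (loops and multiple edges allowed), each edge being an arc of positive length parametrized by arc length between two vertices, where the open edges are embedded, pairwise disjoint and contain no vertex, the vertices and open edges cover $Y$, and the metric of $Y$ is the shortest path metric. Its first Betti number $\beta_1(Y)$ is the dimension of $H_1(Y;\mathbb{Q})=\ker(\partial\colon C_1\to C_0)$, and $N_{E,Y}(\ell)$ is the number of edges of $Y$ of length at most $\ell$. A metric space is *geodesic* if any two points $x,x'$ are joined by an isometric copy of the segment $[0,d(x,x')]$. A space $X$ is *$R$-dense* if for all $x,x'\in X$ there are $x_0=x,x_1,\dots,x_n=x'$ in $X$ with $d_X(x_i,x_{i+1})\le R$ for all $i<n$ and $d_X(x,x')=\sum_{i<n}d_X(x_i,x_{i+1})$. Metric spaces $X$ and $Y$ are *$(\varepsilon,R)$-approximations* of each other if there is a correspondence $C\subset X\times Y$ (every $x\in X$ and every $y\in Y$ occurs in some pair of $C$) such that $|d_X(x_1,x_2)-d_Y(y_1,y_2)|\le 2\varepsilon$ for all $(x_1,y_1),(x_2,y_2)\in C$ with $\min\{d_X(x_1,x_2),d_Y(y_1,y_2)\}\le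 R$. Let $X$ be a compact geodesic space, $r\in X$, $d=d_X(r,\cdot)$, $\alpha>0$, and let $\mathcal I=\{I_i\}$ be a finite covering of $[0,\operatorname{diam}X]$ by open intervals of length at most $\alpha$. Let $\sim_\alpha$ be the transitive closure of the relation "$d(x)=d(y)$ and $x,y$ lie in the same path component of $d^{-1}(I_i)$ for some $i$", and let $d_*$ be the function induced by $d$ on the quotient space $X/{\sim_\alpha}$. The *$\alpha$-Reeb graph* $G_\alpha$ is $X/{\sim_\alpha}$ with the length metric in which the distance of $p$ and $q$ is the infimum of the total variation of $d_*$ along paths from $p$ to $q$ in $X/{\sim_\alpha}$ (points at distance $0$ being identified). **Theorem ($\alpha$-Reeb Reconstruction).** Let $(G,d_G)$ be a compact metric graph of diameter $M$, let $X,r,\alpha,\mathcal I$ be as above, and suppose that $G_\alpha$ is a finite graph, that is, a metric graph. Let $\varepsilon>0$. 1. If $R>0$ and $X$ is $R$-dense and an $(\varepsilon,R)$-approximation of $G$, then $$d_{GH}(X,G_\alpha)\le(\beta_1(G_\alpha)+1)\cdot 4\Bigl(2+N_{E,G}\bigl(4(\alpha+\tfrac{4\varepsilon M}{R}+4\varepsilon)\bigr)\Bigr)\Bigl(\alpha+\tfrac{4\varepsilon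 M}{R}+4\varepsilon\Bigr)+\Bigl(\tfrac{4M}{R}+2\Bigr)\varepsilon .$$ 2. As $R\to\infty$, the right-hand side of this inequality converges to $$(\beta_1(G_\alpha)+1)\cdot 4\bigl(2+N_{E,G}(4(\alpha+4\varepsilon))\bigr)(\alpha+4\varepsilon)+2\varepsilon ,$$ and if $X$ is $R$-dense and an $(\varepsilon,R)$-approximation of $G$ for arbitrarily large $R$, then $d_{GH}(X,G_\alpha)$ is at most this limit. -/

import Mathlib

open Set Filter Topology
open scoped ENNReal

noncomputable section

/-! ### Geodesic spaces, density, local approximation -/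

/-- Any two points are joined by a shortest path, i.e. by an isometric copy of a segment. -/
class GeodesicSpace (X : Type*) [MetricSpace X] : Prop where
  exists_geodesic : ∀ x y : X, ∃ γ : ℝ → X, γ 0 = x ∧ γ (dist x y) = y ∧
    ∀ s ∈ Icc (0 : ℝ) (dist x y), ∀ t ∈ Icc (0 : ℝ) (dist x y), dist (γ s) (γ t) = |s - t|

/-- `X` is `Δ`-dense: any two points are joined by a finite sequence of points with steps of
length at most `Δ` whose lengths add up exactly to the distance. -/
def IsDeltaDense (Δ : ℝ) (X : Type*) [MetricSpace X] : Prop :=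
  ∀ x x' : X, ∃ (n : ℕ) (u : ℕ → X), u 0 = x ∧ u n = x' ∧
    (∀ i < n, dist (u i) (u (i + 1)) ≤ Δ) ∧
    dist x x' = ∑ i ∈ Finset.range n, dist (u i) (u (i + 1))

/-- `C` is a correspondence between `X` and `Y`. -/
def IsCorrespondence {X Y : Type*} (C : Set (X × Y)) : Prop :=
  (∀ x, ∃ y, (x, y) ∈ C) ∧ (∀ y, ∃ x, (x, y) ∈ C)

/-- `X` and `Y` are `(ε, R)`-approximations of each other. -/
def IsLocalApprox (ε R : ℝ) (X Y : Type*) [MetricSpace X] [MetricSpace Y] : Prop :=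
  ∃ C : Set (X × Y), IsCorrespondence C ∧
    ∀ p ∈ C, ∀ q ∈ C, min (dist p.1 q.1) (dist p.2 q.2) ≤ R →
      |dist p.1 q.1 - dist p.2 q.2| ≤ 2 * ε

/-! ### Metric graphs -/

/-- A finite metric graph structure on a metric space `Y`: finitely many vertices (points of `Y`)
and finitely many edges (loops and multiple edges are allowed), each edge being an arc of positive
length parametrized by arc length that joins two vertices; `Y` is the disjoint union of the
vertices and the open edges, and the metric of `Y` is the shortest path metric. -/
structure MetricGraph (Y : Type*) [MetricSpace Y] where
  /-- the vertices -/
  V : Type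
  /-- the edges -/
  E : Type
  [fintypeV : Fintype V]
  [fintypeE : Fintype E]
  /-- the vertices as points of `Y` -/
  point : V → Y
  /-- the initial vertex of an edge -/
  src : E → V
  /-- the terminal vertex of an edge -/
  tgt : E → V
  /-- the length of an edge -/
  len : E → ℝ
  /-- the parametrization of an edge `e` by `[0, len e]` -/
  param : E → ℝ → Y
  len_pos : ∀ e, 0 < len e
  param_zero : ∀ e, param e 0 = point (src e)
  param_len : ∀ e, param e (len e) = point (tgt e)
  /-- The parametrization is by arc length. -/
  arclength : ∀ e, ∀ s t, 0 ≤ s → s ≤ t → t ≤ len e →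
    eVariationOn (param e) (Icc s t) = ENNReal.ofReal (t - s)
  point_injective : Function.Injective point
  /-- Open edges are embedded and pairwise disjoint. -/
  param_injective : ∀ e e', ∀ s ∈ Ioo 0 (len e), ∀ s' ∈ Ioo 0 (len e'),
    param e s = param e' s' → e = e' ∧ s = s'
  /-- Open edges contain no vertex. -/
  param_ne_point : ∀ e, ∀ s ∈ Ioo 0 (len e), ∀ v, param e s ≠ point v
  covers : ∀ y, (∃ v, point v = y) ∨ ∃ e, ∃ s ∈ Ioo 0 (len e), param e s = y
  /-- The metric is the shortest path metric. -/
  geodesic : GeodesicSpace Y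

attribute [instance] MetricGraph.fintypeV MetricGraph.fintypeE

namespace MetricGraph

variable {Y : Type*} [MetricSpace Y]

/-- The number of edges of length at most `ℓ`. -/
def edgeCount (G : MetricGraph Y) (ℓ : ℝ) : ℕ := Nat.card {e : G.E // G.len e ≤ ℓ}

open Classical in
/-- The boundary map `C₁ → C₀` of the graph (rational coefficients): `e ↦ tgt e - src e`. -/
def boundary (G : MetricGraph Y) : (G.E → ℚ) →ₗ[ℚ] (G.V → ℚ) :=
  Fintype.linearCombination ℚ
    (fun e => (Pi.single (G.tgt e) 1 - Pi.single (G.src e) 1 : G.V → ℚ))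

/-- The first Betti number: the dimension of `H₁ = ker (C₁ → C₀)`. -/
def betti1 (G : MetricGraph Y) : ℕ := Module.finrank ℚ (LinearMap.ker G.boundary)

end MetricGraph

/-! ### The `α`-Reeb graph of the distance from `r`, for the intervals `(a i, b i)` -/

section Reeb

variable {X : Type*} [MetricSpace X] {ι : Type*}

/-- `x` and `y` have the same distance `d` from `r` and lie in the same path component of
`d ⁻¹ (a i, b i)` for some `i`. -/
def reebRel (r : X) (a b : ι → ℝ) (x y : X) : Prop :=
  dist r x = dist r y ∧ ∃ i, JoinedIn ((fun z => dist r z) ⁻¹' Ioo (a i) (b i)) x y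

/-- The equivalence relation generated by `reebRel`. (That relation is symmetric, and it is
reflexive if the intervals cover the range of `d`; then this is its transitive closure.) -/
def reebSetoid (r : X) (a b : ι → ℝ) : Setoid X := Relation.EqvGen.setoid (reebRel r a b)

/-- The quotient space `X / ∼`, with the quotient topology. -/
def ReebQuotient (r : X) (a b : ι → ℝ) : Type _ := Quotient (reebSetoid r a b)

instance (r : X) (a b : ι → ℝ) : TopologicalSpace (ReebQuotient r a b) :=
  inferInstanceAs (TopologicalSpace (Quotient (reebSetoid r a b)))

/-- The quotient map. -/
def ReebQuotient.mk (r : X) (a b : ι → ℝ) (x : X) : ReebQuotient r a b :=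
  Quotient.mk (reebSetoid r a b) x

theorem ReebQuotient.continuous_mk (r : X) (a b : ι → ℝ) : Continuous (ReebQuotient.mk r a b) :=
  continuous_quotient_mk'

theorem ReebQuotient.mk_surjective (r : X) (a b : ι → ℝ) :
    Function.Surjective (ReebQuotient.mk r a b) := Quotient.mk_surjective

theorem dist_eq_of_eqvGen (r : X) (a b : ι → ℝ) (x y : X)
    (h : Relation.EqvGen (reebRel r a b) x y) : dist r x = dist r y := by
  induction h with
  | rel x y h => exact h.1
  | refl x => rfl
  | symm x y _ ih => exact ih.symm
  | trans x y z _ _ ih1 ih2 => exact ih1.trans ih2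

/-- The function `d_*` induced on the quotient by `d`. -/
def ReebQuotient.height (r : X) (a b : ι → ℝ) : ReebQuotient r a b → ℝ :=
  Quotient.lift (fun x => dist r x) (fun x y h => dist_eq_of_eqvGen r a b x y h)

/-- The intrinsic (length) distance on the quotient: the infimum, over all paths from `p` to `q`
in the quotient space, of the total variation of `d_*` along the path. (So an arc on which `d_*` is
strictly monotone is isometric, through `d_*`, to an interval.) -/
def reebEDist (r : X) (a b : ι → ℝ) (p q : ReebQuotient r a b) : ℝ≥0∞ :=
  ⨅ γ : Path p q, eVariationOn (fun t => ReebQuotient.height r a b (γ t)) univ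

theorem reebEDist_self (r : X) (a b : ι → ℝ) (p : ReebQuotient r a b) :
    reebEDist r a b p p = 0 := by
  refine le_antisymm (iInf_le_of_le (Path.refl p) (le_of_eq ?_)) bot_le
  apply eVariationOn.constant_on
  rintro _ ⟨s, _, rfl⟩ _ ⟨t, _, rfl⟩
  rfl

theorem reebEDist_comm_le (r : X) (a b : ι → ℝ) (p q : ReebQuotient r a b) :
    reebEDist r a b p q ≤ reebEDist r a b q p := by
  refine le_iInf fun γ => iInf_le_of_le γ.symm ?_
  exact eVariationOn.comp_le_of_antitoneOn (fun t => ReebQuotient.height r a b (γ t))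
    unitInterval.symm (fun s _ t _ h => unitInterval.symm_le_symm.2 h) (mapsTo_univ _ _)

theorem reebEDist_comm (r : X) (a b : ι → ℝ) (p q : ReebQuotient r a b) :
    reebEDist r a b p q = reebEDist r a b q p :=
  le_antisymm (reebEDist_comm_le r a b p q) (reebEDist_comm_le r a b q p)

theorem eVariationOn_path_trans_le {Q : Type*} [TopologicalSpace Q] (f : Q → ℝ) {p q s : Q}
    (γ : Path p q) (δ : Path q s) :
    eVariationOn (fun t => f ((γ.trans δ) t)) univ ≤
      eVariationOn (fun t => f (γ t)) univ + eVariationOn (fun t => f (δ t)) univ := by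
  set m : unitInterval := ⟨1 / 2, by norm_num, by norm_num⟩ with hm
  have hu : (univ : Set unitInterval) = Iic m ∪ Ici m := Iic_union_Ici.symm
  have h1 : eVariationOn (fun t => f ((γ.trans δ) t)) (Iic m) ≤
      eVariationOn (fun t => f (γ t)) univ := by
    have e : EqOn (fun t => f ((γ.trans δ) t))
        ((fun t => f (γ t)) ∘ fun t : unitInterval =>
          projIcc (0 : ℝ) 1 zero_le_one (2 * (t : ℝ))) (Iic m) := by
      intro t ht
      have ht' : (t : ℝ) ≤ 1 / 2 := ht
      have h2 : 2 * (t : ℝ) ∈ Icc (0 : ℝ) 1 := ⟨by linarith [t.2.1], by linarith⟩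
      simp only [Function.comp, Path.trans_apply, dif_pos ht', projIcc_of_mem zero_le_one h2]
    rw [eVariationOn.congr e]
    refine eVariationOn.comp_le_of_monotoneOn _ _ (fun x _ y _ h => ?_) (mapsTo_univ _ _)
    exact monotone_projIcc _ (by have : (x : ℝ) ≤ y := h; linarith)
  have h2 : eVariationOn (fun t => f ((γ.trans δ) t)) (Ici m) ≤
      eVariationOn (fun t => f (δ t)) univ := by
    have e : EqOn (fun t => f ((γ.trans δ) t))
        ((fun t => f (δ t)) ∘ fun t : unitInterval =>
          projIcc (0 : ℝ) 1 zero_le_one (2 * (t : ℝ) - 1)) (Ici m) := by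
      intro t ht
      have ht' : 1 / 2 ≤ (t : ℝ) := ht
      have h2 : 2 * (t : ℝ) - 1 ∈ Icc (0 : ℝ) 1 := ⟨by linarith, by linarith [t.2.2]⟩
      by_cases h : (t : ℝ) ≤ 1 / 2
      · have h3 : (t : ℝ) = 1 / 2 := le_antisymm h ht'
        have h4 : projIcc (0 : ℝ) 1 zero_le_one (2 * (t : ℝ) - 1) = 0 := by
          rw [h3]; exact projIcc_of_le_left _ (by norm_num)
        have h5 : (⟨2 * (t : ℝ), by constructor <;> linarith⟩ : unitInterval) = 1 := by
          ext; simp [h3]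
        simp only [Function.comp, Path.trans_apply, dif_pos h, h4]
        rw [h5, γ.target, δ.source]
      · simp only [Function.comp, Path.trans_apply, dif_neg h, projIcc_of_mem zero_le_one h2]
    rw [eVariationOn.congr e]
    refine eVariationOn.comp_le_of_monotoneOn _ _ (fun x _ y _ h => ?_) (mapsTo_univ _ _)
    exact monotone_projIcc _ (by have : (x : ℝ) ≤ y := h; linarith)
  rw [hu, eVariationOn.union _ isGreatest_Iic isLeast_Ici, ← hu]
  exact add_le_add h1 h2

theorem reebEDist_triangle (r : X) (a b : ι → ℝ) (p q s : ReebQuotient r a b) :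
    reebEDist r a b p s ≤ reebEDist r a b p q + reebEDist r a b q s := by
  unfold reebEDist
  rw [ENNReal.iInf_add]
  refine le_iInf fun γ => ?_
  rw [ENNReal.add_iInf]
  exact le_iInf fun δ => iInf_le_of_le (γ.trans δ) (eVariationOn_path_trans_le _ γ δ)

theorem reebEDist_mk_le [GeodesicSpace X] (r : X) (a b : ι → ℝ) (x y : X) :
    reebEDist r a b (ReebQuotient.mk r a b x) (ReebQuotient.mk r a b y) ≤
      ENNReal.ofReal (dist x y) := by
  obtain ⟨γ, h0, h1, hγ⟩ := GeodesicSpace.exists_geodesic x y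
  have hmem : ∀ t : unitInterval, dist x y * (t : ℝ) ∈ Icc (0 : ℝ) (dist x y) := fun t =>
    ⟨mul_nonneg dist_nonneg t.2.1, mul_le_of_le_one_right dist_nonneg t.2.2⟩
  have hd : ∀ s t : unitInterval, dist (γ (dist x y * (s : ℝ))) (γ (dist x y * (t : ℝ))) =
      dist x y * dist s t := fun s t => by
    rw [hγ _ (hmem s) _ (hmem t), ← mul_sub, abs_mul, abs_of_nonneg dist_nonneg, Subtype.dist_eq,
      Real.dist_eq]
  have hL : LipschitzWith (Real.toNNReal (dist x y))
      (fun t : unitInterval => γ (dist x y * (t : ℝ))) :=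
    LipschitzWith.of_dist_le_mul fun s t => by
      rw [hd, Real.coe_toNNReal _ dist_nonneg]
  let δ : Path x y :=
    { toFun := fun t => γ (dist x y * (t : ℝ))
      continuous_toFun := hL.continuous
      source' := by simp [h0]
      target' := by simp [h1] }
  refine iInf_le_of_le (δ.map (ReebQuotient.continuous_mk r a b)) ?_
  have hf : LipschitzWith (Real.toNNReal (dist x y))
      (fun t : unitInterval => dist r (γ (dist x y * (t : ℝ)))) := by
    simpa [Function.comp_def] using (LipschitzWith.dist_right r).comp hL
  refine iSup_le fun ⟨n, u, hu, _⟩ => ?_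
  calc ∑ i ∈ Finset.range n, edist (dist r (δ (u (i + 1)))) (dist r (δ (u i)))
      ≤ ∑ i ∈ Finset.range n, ENNReal.ofReal (dist x y * ((u (i + 1) : ℝ) - (u i : ℝ))) := by
        refine Finset.sum_le_sum fun i _ => ?_
        rw [edist_dist]
        refine ENNReal.ofReal_le_ofReal ((hf.dist_le_mul _ _).trans_eq ?_)
        have : (u i : ℝ) ≤ u (i + 1) := hu (Nat.le_succ i)
        rw [Real.coe_toNNReal _ dist_nonneg, Subtype.dist_eq, Real.dist_eq,
          abs_of_nonneg (by linarith)]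
    _ = ENNReal.ofReal (∑ i ∈ Finset.range n, dist x y * ((u (i + 1) : ℝ) - (u i : ℝ))) := by
        rw [ENNReal.ofReal_sum_of_nonneg]
        intro i _
        have : (u i : ℝ) ≤ u (i + 1) := hu (Nat.le_succ i)
        exact mul_nonneg dist_nonneg (by linarith)
    _ ≤ ENNReal.ofReal (dist x y) := by
        refine ENNReal.ofReal_le_ofReal ?_
        rw [← Finset.mul_sum, Finset.sum_range_sub (fun i => (u i : ℝ))]
        refine mul_le_of_le_one_right dist_nonneg ?_
        linarith [(u n).2.2, (u 0).2.1]

theorem reebEDist_ne_top [GeodesicSpace X] (r : X) (a b : ι → ℝ) (p q : ReebQuotient r a b) :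
    reebEDist r a b p q ≠ ∞ := by
  obtain ⟨x, rfl⟩ := ReebQuotient.mk_surjective r a b p
  obtain ⟨y, rfl⟩ := ReebQuotient.mk_surjective r a b q
  exact ne_top_of_le_ne_top ENNReal.ofReal_ne_top (reebEDist_mk_le r a b x y)

/-- The set `X / ∼`, carrying the intrinsic distance instead of the quotient topology. -/
def ReebLengthSpace (r : X) (a b : ι → ℝ) : Type _ := ReebQuotient r a b

instance [GeodesicSpace X] (r : X) (a b : ι → ℝ) : PseudoMetricSpace (ReebLengthSpace r a b) where
  dist p q := (reebEDist r a b p q).toReal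
  dist_self p := (congrArg ENNReal.toReal (reebEDist_self r a b p)).trans ENNReal.toReal_zero
  dist_comm p q := congrArg ENNReal.toReal (reebEDist_comm r a b p q)
  dist_triangle p q s := by
    refine (ENNReal.toReal_mono ?_ (reebEDist_triangle r a b p q s)).trans_eq ?_
    · exact ENNReal.add_ne_top.2 ⟨reebEDist_ne_top r a b p q, reebEDist_ne_top r a b q s⟩
    · exact ENNReal.toReal_add (reebEDist_ne_top r a b p q) (reebEDist_ne_top r a b q s)

/-- The `α`-Reeb graph as a metric space: `X / ∼` with its intrinsic distance, where points at
intrinsic distance `0` are identified. (This identification does not affect Gromov-Hausdorff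
distances. It is needed because, at a level where path components separate, the quotient topology
can have two branch points that have no disjoint neighbourhoods.) -/
def ReebGraph [GeodesicSpace X] (r : X) (a b : ι → ℝ) : Type _ :=
  SeparationQuotient (ReebLengthSpace r a b)

variable [GeodesicSpace X]

instance (r : X) (a b : ι → ℝ) : MetricSpace (ReebGraph r a b) :=
  inferInstanceAs (MetricSpace (SeparationQuotient (ReebLengthSpace r a b)))

/-- The projection of `X` onto the `α`-Reeb graph. -/
def ReebGraph.proj (r : X) (a b : ι → ℝ) (x : X) : ReebGraph r a b :=
  SeparationQuotient.mk (X := ReebLengthSpace r a b) (ReebQuotient.mk r a b x)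

theorem ReebGraph.proj_surjective (r : X) (a b : ι → ℝ) :
    Function.Surjective (ReebGraph.proj r a b) :=
  (SeparationQuotient.surjective_mk (X := ReebLengthSpace r a b)).comp
    (ReebQuotient.mk_surjective r a b)

theorem ReebGraph.dist_proj (r : X) (a b : ι → ℝ) (x y : X) :
    dist (ReebGraph.proj r a b x) (ReebGraph.proj r a b y) =
      (reebEDist r a b (ReebQuotient.mk r a b x) (ReebQuotient.mk r a b y)).toReal := rfl

theorem ReebGraph.continuous_proj (r : X) (a b : ι → ℝ) : Continuous (ReebGraph.proj r a b) := by
  refine (LipschitzWith.of_dist_le_mul (K := 1) fun x y => ?_).continuous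
  rw [ReebGraph.dist_proj, NNReal.coe_one, one_mul]
  exact ENNReal.toReal_le_of_le_ofReal dist_nonneg (reebEDist_mk_le r a b x y)

instance (r : X) (a b : ι → ℝ) : Nonempty (ReebGraph r a b) := ⟨ReebGraph.proj r a b r⟩

instance [CompactSpace X] (r : X) (a b : ι → ℝ) : CompactSpace (ReebGraph r a b) where
  isCompact_univ := by
    rw [← (ReebGraph.proj_surjective r a b).range_eq]
    exact isCompact_range (ReebGraph.continuous_proj r a b)

end Reeb

end

/-! The projection `π` of `X` onto the Reeb graph `T` is surjective, 1-Lipschitz and preserves the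
distance to the root. What remains is to bound how far `dist x y` can exceed `dist (π x) (π y)`, and
two independent estimates do this.

Thin fibres. If `π x` and `π y` are very close, then `x` and `y` are joined in `X` inside an annulus
about `r` of width slightly more than `2α` (`joinedIn_of_dist_proj_lt`). Chaining short steps turns
the local approximation into a global one with error `δ = ε (M / R + 1)`, so the path carries over
to a path of `G` in an annulus of width `2α + 7δ` (`joinedIn_annulus_of_approx`). In a metric graph,
an arc of an edge inside an annulus of width `w` that avoids the centre has length at most `2w`: the
segment from its midpoint to the centre has to run along half of it. A path component of the annulus
is therefore traversed along whole edges of length at most `2w`, plus one piece at either end, and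
has diameter at most `2w (2 + N(2w))` (`dist_le_of_joinedIn_annulus`). This yields a bound `D` for
the distance of points with nearly equal projections.

Few branch points. Descending segments of `T` lift to `X`, because segments from `x` to `r` project
to segments and descent is unique away from branch points. A segment of `T` without branch points
first descends and then ascends, so lifting from both ends to its lowest point costs only `D`.
Jumping over a branch point costs at most `2D` more. An Euler characteristic count shows that there
are at most `β₁(T)` branch points (`card_branchPoints_le`).

Hence the distortion of `π` is at most `(2β₁ + 1) D`, and the Gromov-Hausdorff distance is at most
half of that. The limit statement uses that the edge count is continuous from the right. -/

/-! ### Segments in a metric graph -/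

/-- `g` is an isometric embedding of the set `S` of reals. -/
def IsometricOn {Y : Type*} [MetricSpace Y] (g : ℝ → Y) (S : Set ℝ) : Prop :=
  ∀ s ∈ S, ∀ t ∈ S, dist (g s) (g t) = |s - t|

namespace IsometricOn

variable {Y : Type*} [MetricSpace Y] {g : ℝ → Y} {S S' : Set ℝ}

theorem mono (h : IsometricOn g S) (hS : S' ⊆ S) : IsometricOn g S' :=
  fun s hs t ht => h s (hS hs) t (hS ht)

theorem injOn (h : IsometricOn g S) : InjOn g S := fun s hs t ht e => by
  have := h s hs t ht
  rw [e, dist_self] at this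
  exact sub_eq_zero.1 (abs_eq_zero.1 this.symm)

theorem continuousOn (h : IsometricOn g S) : ContinuousOn g S := by
  have : LipschitzOnWith 1 g S := LipschitzOnWith.of_dist_le_mul fun s hs t ht => by
    rw [h s hs t ht, Real.dist_eq, NNReal.coe_one, one_mul]
  exact this.continuousOn

theorem eVariationOn_Icc {s t : ℝ} (hst : s ≤ t) (h : IsometricOn g (Icc s t)) :
    eVariationOn g (Icc s t) = ENNReal.ofReal (t - s) := by
  refine le_antisymm (iSup_le fun ⟨n, u, hu, hus⟩ => ?_) ?_
  · have key : ∀ i, edist (g (u (i + 1))) (g (u i)) = ENNReal.ofReal (u (i + 1) - u i) := fun i => by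
      rw [edist_dist, h _ (hus _) _ (hus _), abs_of_nonneg (sub_nonneg.2 (hu (Nat.le_succ i)))]
    simp only [key]
    rw [← ENNReal.ofReal_sum_of_nonneg fun i _ => sub_nonneg.2 (hu (Nat.le_succ i)),
      Finset.sum_range_sub]
    exact ENNReal.ofReal_le_ofReal (by linarith [(hus n).2, (hus 0).1])
  · refine le_trans (le_of_eq ?_)
      (eVariationOn.edist_le g (right_mem_Icc.2 hst) (left_mem_Icc.2 hst))
    rw [edist_dist, h _ (right_mem_Icc.2 hst) _ (left_mem_Icc.2 hst),
      abs_of_nonneg (sub_nonneg.2 hst)]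

end IsometricOn

theorem GeodesicSpace.exists_isometricOn {Y : Type*} [MetricSpace Y] [GeodesicSpace Y] (x y : Y) :
    ∃ g : ℝ → Y, g 0 = x ∧ g (dist x y) = y ∧ IsometricOn g (Icc 0 (dist x y)) :=
  GeodesicSpace.exists_geodesic x y

namespace MetricGraph

variable {Y : Type*} [MetricSpace Y] (G : MetricGraph Y)

theorem dist_param_le (e : G.E) {s t : ℝ} (hs : s ∈ Icc 0 (G.len e)) (ht : t ∈ Icc 0 (G.len e)) :
    dist (G.param e s) (G.param e t) ≤ |s - t| := by
  wlog hst : s ≤ t generalizing s t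
  · rw [dist_comm, abs_sub_comm]; exact this ht hs (le_of_not_ge hst)
  have h1 := eVariationOn.edist_le (G.param e) (left_mem_Icc.2 hst) (right_mem_Icc.2 hst)
  rw [G.arclength e s t hs.1 hst ht.2, edist_dist] at h1
  rw [abs_sub_comm, abs_of_nonneg (sub_nonneg.2 hst)]
  exact (ENNReal.ofReal_le_ofReal_iff (sub_nonneg.2 hst)).1 h1

theorem continuousOn_param (e : G.E) : ContinuousOn (G.param e) (Icc 0 (G.len e)) := by
  have : LipschitzOnWith 1 (G.param e) (Icc 0 (G.len e)) :=
    LipschitzOnWith.of_dist_le_mul fun s hs t ht => by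
      rw [NNReal.coe_one, one_mul, Real.dist_eq]; exact G.dist_param_le e hs ht
  exact this.continuousOn

theorem isClosed_param_image (e : G.E) {s t : ℝ} (hs : 0 ≤ s) (ht : t ≤ G.len e) :
    IsClosed (G.param e '' Icc s t) :=
  (isCompact_Icc.image_of_continuousOn
    ((G.continuousOn_param e).mono (Icc_subset_Icc hs ht))).isClosed

theorem isClosed_range_point : IsClosed (range G.point) := (finite_range G.point).isClosed

/-- A point of a closed edge that is not a vertex has its parameter in the open interval. -/
theorem mem_Ioo_of_not_mem_range {e : G.E} {s : ℝ} (hs : s ∈ Icc 0 (G.len e))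
    (h : G.param e s ∉ range G.point) : s ∈ Ioo 0 (G.len e) := by
  refine ⟨lt_of_le_of_ne hs.1 ?_, lt_of_le_of_ne hs.2 ?_⟩
  · rintro rfl; exact h ⟨_, (G.param_zero e).symm⟩
  · rintro rfl; exact h ⟨_, (G.param_len e).symm⟩

theorem param_not_mem_range {e : G.E} {s : ℝ} (hs : s ∈ Ioo 0 (G.len e)) :
    G.param e s ∉ range G.point := fun ⟨v, hv⟩ => G.param_ne_point e s hs v hv.symm

theorem eq_of_param_eq {e e' : G.E} {s s' : ℝ} (hs : s ∈ Ioo 0 (G.len e))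
    (hs' : s' ∈ Icc 0 (G.len e')) (h : G.param e s = G.param e' s') : e = e' ∧ s = s' :=
  G.param_injective e e' s hs s'
    (G.mem_Ioo_of_not_mem_range hs' (h ▸ G.param_not_mem_range hs)) h

theorem exists_param_of_not_mem_range {y : Y} (h : y ∉ range G.point) :
    ∃ e, ∃ s ∈ Ioo 0 (G.len e), G.param e s = y := (G.covers y).resolve_left h

/-- The complement consists of the vertices, the other closed edges and two closed arcs of `e`:
finitely many compact sets. -/
theorem isOpen_param_image (e : G.E) {s t : ℝ} (hs : 0 ≤ s) (ht : t ≤ G.len e) :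
    IsOpen (G.param e '' Ioo s t) := by
  have h : (G.param e '' Ioo s t)ᶜ = range G.point ∪
      ((⋃ e' ∈ {e' | e' ≠ e}, G.param e' '' Icc 0 (G.len e')) ∪
        (G.param e '' Icc 0 (min s (G.len e)) ∪ G.param e '' Icc (max 0 t) (G.len e))) := by
    ext y
    constructor
    · intro hy
      by_cases hv : y ∈ range G.point
      · exact Or.inl hv
      obtain ⟨e', u, hu, rfl⟩ := G.exists_param_of_not_mem_range hv
      by_cases he : e' = e
      · subst he
        refine Or.inr (Or.inr ?_)
        rcases le_or_gt u s with h | h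
        · exact Or.inl ⟨u, ⟨hu.1.le, le_min h hu.2.le⟩, rfl⟩
        · refine Or.inr ⟨u, ⟨max_le hu.1.le (not_lt.1 fun h' => hy ⟨u, ⟨h, h'⟩, rfl⟩), hu.2.le⟩, rfl⟩
      · exact Or.inr (Or.inl (mem_iUnion₂.2 ⟨e', he, u, Ioo_subset_Icc_self hu, rfl⟩))
    · rintro hy ⟨u, hu, rfl⟩
      have hu' : u ∈ Ioo 0 (G.len e) := ⟨hs.trans_lt hu.1, hu.2.trans_le ht⟩
      rcases hy with hy | hy | ⟨u', h', h⟩ | ⟨u', h', h⟩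
      · exact G.param_not_mem_range hu' hy
      · obtain ⟨e', he, u', h', h⟩ := mem_iUnion₂.1 hy
        exact he (G.eq_of_param_eq hu' h' h.symm).1.symm
      · have := (G.eq_of_param_eq hu' ⟨h'.1, h'.2.trans (min_le_right _ _)⟩ h.symm).2
        linarith [hu.1, h'.2, min_le_left s (G.len e)]
      · have := (G.eq_of_param_eq hu' ⟨(le_max_left _ _).trans h'.1, h'.2⟩ h.symm).2
        linarith [hu.2, h'.1, le_max_right 0 t]
  rw [← isClosed_compl_iff, h]
  refine G.isClosed_range_point.union (IsClosed.union ?_ (IsClosed.union ?_ ?_))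
  · exact (toFinite _).isClosed_biUnion fun e' _ => G.isClosed_param_image e' le_rfl le_rfl
  · exact G.isClosed_param_image e le_rfl (min_le_right _ _)
  · exact G.isClosed_param_image e (le_max_left _ _) le_rfl

/-- A segment without vertices stays in an open edge. -/
theorem exists_edge_of_off_vertices {g : ℝ → Y} {a b : ℝ} (hab : a < b)
    (hc : ContinuousOn g (Ioo a b)) (hv : ∀ u ∈ Ioo a b, g u ∉ range G.point) :
    ∃ e, ∀ u ∈ Ioo a b, ∃ s ∈ Ioo 0 (G.len e), G.param e s = g u := by
  obtain ⟨u₀, hu₀⟩ : (Ioo a b).Nonempty := nonempty_Ioo.2 hab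
  obtain ⟨e, s₀, hs₀, h₀⟩ := G.exists_param_of_not_mem_range (hv u₀ hu₀)
  refine ⟨e, fun u hu => ?_⟩
  have hpre : IsPreconnected (g '' Ioo a b) := isPreconnected_Ioo.image g hc
  -- The open edges are open and pairwise disjoint, so a connected set off the vertices lies in only
  -- one of them.
  have hsub := hpre.subset_left_of_subset_union (u := G.param e '' Ioo 0 (G.len e))
    (v := ⋃ e' ∈ {e' | e' ≠ e}, G.param e' '' Ioo 0 (G.len e'))
    (G.isOpen_param_image e le_rfl le_rfl)
    (isOpen_biUnion fun e' _ => G.isOpen_param_image e' le_rfl le_rfl) ?_ ?_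
    ⟨g u₀, mem_image_of_mem g hu₀, s₀, hs₀, h₀⟩
  · exact hsub (mem_image_of_mem g hu)
  · rw [Set.disjoint_left]
    rintro _ ⟨s, hs, rfl⟩ hy
    obtain ⟨e', he, s', hs', h⟩ := mem_iUnion₂.1 hy
    exact he (G.param_injective e' e s' hs' s hs h).1
  · rintro _ ⟨u, hu, rfl⟩
    obtain ⟨e', s, hs, h⟩ := G.exists_param_of_not_mem_range (hv u hu)
    by_cases he : e' = e
    · subst he; exact Or.inl ⟨s, hs, h⟩
    · exact Or.inr (mem_iUnion₂.2 ⟨e', he, s, hs, h⟩)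

/-- An isometrically embedded open segment without vertices runs along an edge with unit speed. -/
theorem exists_param_eq_of_Ioo {g : ℝ → Y} {a b : ℝ} (hab : a < b) (hg : IsometricOn g (Ioo a b))
    (hv : ∀ u ∈ Ioo a b, g u ∉ range G.point) :
    ∃ e, ∃ σ c : ℝ, (σ = 1 ∨ σ = -1) ∧
      ∀ u ∈ Ioo a b, c + σ * u ∈ Ioo 0 (G.len e) ∧ g u = G.param e (c + σ * u) := by
  obtain ⟨e, he⟩ := G.exists_edge_of_off_vertices hab hg.continuousOn hv
  choose! φ hφ hφg using he
  have hinj : InjOn φ (Ioo a b) := fun u hu u' hu' h => hg.injOn hu hu' (by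
    rw [← hφg u hu, ← hφg u' hu', h])
  have hcont : ContinuousOn φ (Ioo a b) := by
    intro u hu
    rw [ContinuousWithinAt, tendsto_order]
    have aux : ∀ l r, 0 ≤ l → r ≤ G.len e → φ u ∈ Ioo l r → ∀ᶠ u' in 𝓝[Ioo a b] u, φ u' ∈ Ioo l r := by
      intro l r hl hr hm
      have h1 : ∀ᶠ u' in 𝓝[Ioo a b] u, g u' ∈ G.param e '' Ioo l r :=
        (hg.continuousOn u hu).eventually
          ((G.isOpen_param_image e hl hr).mem_nhds ⟨φ u, hm, hφg u hu⟩)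
      filter_upwards [h1, self_mem_nhdsWithin] with u' ⟨s, hs, hs'⟩ hu'
      rw [← hφg u' hu'] at hs'
      have := (G.param_injective e e s ⟨hl.trans_lt hs.1, hs.2.trans_le hr⟩ _ (hφ u' hu') hs').2
      exact this ▸ hs
    refine ⟨fun l hl => ?_, fun r hr => ?_⟩
    · filter_upwards [aux (max l 0) (G.len e) (le_max_right _ _) le_rfl
        ⟨max_lt hl (hφ u hu).1, (hφ u hu).2⟩] with u' hu'
      exact (le_max_left _ _).trans_lt hu'.1
    · filter_upwards [aux 0 (min r (G.len e)) le_rfl (min_le_right _ _)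
        ⟨(hφ u hu).1, lt_min hr (hφ u hu).2⟩] with u' hu'
      exact hu'.2.trans_le (min_le_left _ _)
  -- Both `g` and the edge are parametrized by arc length. Computing the variation in either
  -- parameter shows that the monotone reparametrization `φ` has slope `1` or `-1`.
  have hvar : ∀ u ∈ Ioo a b, ∀ u' ∈ Ioo a b, u ≤ u' →
      eVariationOn (G.param e ∘ φ) (Icc u u') = ENNReal.ofReal (u' - u) := by
    intro u hu u' hu' huu
    have hsub : Icc u u' ⊆ Ioo a b := fun x hx => ⟨hu.1.trans_le hx.1, hx.2.trans_lt hu'.2⟩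
    rw [← (hg.mono hsub).eVariationOn_Icc huu]
    exact eVariationOn.congr fun x hx => hφg x (hsub hx)
  obtain ⟨u₀, hu₀⟩ : (Ioo a b).Nonempty := nonempty_Ioo.2 hab
  rcases hcont.strictMonoOn_of_injOn_Ioo hab hinj with hm | hm
  · have key : ∀ u ∈ Ioo a b, ∀ u' ∈ Ioo a b, u ≤ u' → φ u' - φ u = u' - u := by
      intro u hu u' hu' huu
      have hsub : Icc u u' ⊆ Ioo a b := fun x hx => ⟨hu.1.trans_le hx.1, hx.2.trans_lt hu'.2⟩
      have hle : φ u ≤ φ u' := hm.monotoneOn hu hu' huu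
      have himg : φ '' Icc u u' = Icc (φ u) (φ u') := by
        refine Subset.antisymm ?_ (intermediate_value_Icc huu (hcont.mono hsub))
        rintro _ ⟨x, hx, rfl⟩
        exact ⟨hm.monotoneOn hu (hsub hx) hx.1, hm.monotoneOn (hsub hx) hu' hx.2⟩
      have h1 := hvar u hu u' hu' huu
      rw [eVariationOn.comp_eq_of_monotoneOn _ _ (hm.monotoneOn.mono hsub), himg,
        G.arclength e _ _ (hφ u hu).1.le hle (hφ u' hu').2.le] at h1
      exact (ENNReal.ofReal_eq_ofReal_iff (sub_nonneg.2 hle) (sub_nonneg.2 huu)).1 h1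
    refine ⟨e, 1, φ u₀ - u₀, Or.inl rfl, fun u hu => ?_⟩
    have : φ u₀ - u₀ + 1 * u = φ u := by
      rcases le_total u₀ u with h | h
      · linarith [key u₀ hu₀ u hu h]
      · linarith [key u hu u₀ hu₀ h]
    rw [this]
    exact ⟨hφ u hu, (hφg u hu).symm⟩
  · have key : ∀ u ∈ Ioo a b, ∀ u' ∈ Ioo a b, u ≤ u' → φ u - φ u' = u' - u := by
      intro u hu u' hu' huu
      have hsub : Icc u u' ⊆ Ioo a b := fun x hx => ⟨hu.1.trans_le hx.1, hx.2.trans_lt hu'.2⟩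
      have hle : φ u' ≤ φ u := hm.antitoneOn hu hu' huu
      have himg : φ '' Icc u u' = Icc (φ u') (φ u) := by
        refine Subset.antisymm ?_ (intermediate_value_Icc' huu (hcont.mono hsub))
        rintro _ ⟨x, hx, rfl⟩
        exact ⟨hm.antitoneOn (hsub hx) hu' hx.2, hm.antitoneOn hu (hsub hx) hx.1⟩
      have h1 := hvar u hu u' hu' huu
      rw [eVariationOn.comp_eq_of_antitoneOn _ _ (hm.antitoneOn.mono hsub), himg,
        G.arclength e _ _ (hφ u' hu').1.le hle (hφ u hu).2.le] at h1
      exact (ENNReal.ofReal_eq_ofReal_iff (sub_nonneg.2 hle) (sub_nonneg.2 huu)).1 h1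
    refine ⟨e, -1, φ u₀ + u₀, Or.inr rfl, fun u hu => ?_⟩
    have : φ u₀ + u₀ + -1 * u = φ u := by
      rcases le_total u₀ u with h | h
      · linarith [key u₀ hu₀ u hu h]
      · linarith [key u hu u₀ hu₀ h]
    rw [this]
    exact ⟨hφ u hu, (hφg u hu).symm⟩

/-- An isometrically embedded segment without vertices in its interior runs along an edge. -/
theorem exists_param_eq_of_Icc {g : ℝ → Y} {a b : ℝ} (hab : a < b) (hg : IsometricOn g (Icc a b))
    (hv : ∀ u ∈ Ioo a b, g u ∉ range G.point) :
    ∃ e, ∃ σ c : ℝ, (σ = 1 ∨ σ = -1) ∧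
      ∀ u ∈ Icc a b, c + σ * u ∈ Icc 0 (G.len e) ∧ g u = G.param e (c + σ * u) := by
  obtain ⟨e, σ, c, hσ, h⟩ := G.exists_param_eq_of_Ioo hab (hg.mono Ioo_subset_Icc_self) hv
  have hcl : Icc a b ⊆ closure (Ioo a b) := by rw [closure_Ioo hab.ne]
  have hc : Continuous fun u : ℝ => c + σ * u := by fun_prop
  have hmaps : MapsTo (fun u : ℝ => c + σ * u) (Icc a b) (Icc 0 (G.len e)) := fun u hu =>
    closure_minimal (s := (fun u : ℝ => c + σ * u) '' Ioo a b)
      (by rintro _ ⟨u, hu, rfl⟩; exact Ioo_subset_Icc_self (h u hu).1) isClosed_Icc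
      (image_closure_subset_closure_image hc (mem_image_of_mem _ (hcl hu)))
  have heq : EqOn g (fun u => G.param e (c + σ * u)) (Icc a b) :=
    Set.EqOn.of_subset_closure (s := Ioo a b) (fun u hu => (h u hu).2) hg.continuousOn
      ((G.continuousOn_param e).comp hc.continuousOn hmaps) Ioo_subset_Icc_self hcl
  exact ⟨e, σ, c, hσ, fun u hu => ⟨hmaps hu, heq hu⟩⟩

/-- The times at which an isometrically embedded segment meets a vertex are finitely many. -/
theorem finite_vertex_times {g : ℝ → Y} {S : Set ℝ} (hg : IsometricOn g S) :
    {u ∈ S | g u ∈ range G.point}.Finite :=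
  Finite.of_finite_image ((finite_range G.point).subset (by rintro _ ⟨u, hu, rfl⟩; exact hu.2))
    (hg.injOn.mono fun u hu => hu.1)

/-- A nondegenerate segment starts along an edge. -/
theorem exists_germ {g : ℝ → Y} {ℓ : ℝ} (hℓ : 0 < ℓ) (hg : IsometricOn g (Icc 0 ℓ)) :
    ∃ e, ∃ σ c η : ℝ, (σ = 1 ∨ σ = -1) ∧ 0 < η ∧ η ≤ ℓ ∧
      ∀ u ∈ Icc 0 η, c + σ * u ∈ Icc 0 (G.len e) ∧ g u = G.param e (c + σ * u) := by
  have hfin : ({u ∈ Icc 0 ℓ | g u ∈ range G.point} \ {0}).Finite :=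
    (G.finite_vertex_times hg).subset sdiff_subset
  have hmem : ({u ∈ Icc 0 ℓ | g u ∈ range G.point} \ {0})ᶜ ∈ 𝓝 (0 : ℝ) :=
    hfin.isClosed.isOpen_compl.mem_nhds fun h => h.2 rfl
  obtain ⟨η, hη, hball⟩ := Metric.mem_nhds_iff.1 hmem
  have h0 : 0 < min η ℓ := lt_min hη hℓ
  obtain ⟨e, σ, c, hσ, h⟩ := G.exists_param_eq_of_Icc h0
    (hg.mono (Icc_subset_Icc le_rfl (min_le_right _ _))) fun u hu hur => by
      refine hball (?_ : u ∈ Metric.ball 0 η) ⟨⟨⟨hu.1.le, hu.2.le.trans (min_le_right _ _)⟩, hur⟩,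
        hu.1.ne'⟩
      rw [Metric.mem_ball, Real.dist_eq, sub_zero, abs_of_pos hu.1]
      exact hu.2.trans_le (min_le_left _ _)
  exact ⟨e, σ, c, min η ℓ, hσ, h0, min_le_right _ _, h⟩

/-- A segment that starts in an open edge follows this edge until it leaves the edge. -/
theorem exists_follow {e : G.E} {u : ℝ} (hu : u ∈ Ioo 0 (G.len e)) {g : ℝ → Y} {ℓ : ℝ} (hℓ : 0 < ℓ)
    (hg : IsometricOn g (Icc 0 ℓ)) (h0 : g 0 = G.param e u) :
    ∃ σ : ℝ, (σ = 1 ∨ σ = -1) ∧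
      ∀ τ ∈ Icc 0 ℓ, u + σ * τ ∈ Icc 0 (G.len e) → g τ = G.param e (u + σ * τ) := by
  have hstart : ∀ {e' : G.E} {σ c τ₁ : ℝ}, 0 < τ₁ →
      (∀ τ ∈ Icc 0 τ₁, c + σ * τ ∈ Icc 0 (G.len e') ∧ g τ = G.param e' (c + σ * τ)) →
      e' = e ∧ c = u := by
    intro e' σ c τ₁ hτ h
    obtain ⟨h1, h2⟩ := h 0 (left_mem_Icc.2 hτ.le)
    rw [mul_zero, add_zero] at h1 h2
    obtain ⟨h3, h4⟩ := G.eq_of_param_eq hu h1 (h0 ▸ h2)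
    exact ⟨h3.symm, h4.symm⟩
  have hfin := G.finite_vertex_times hg
  rcases eq_empty_or_nonempty {τ ∈ Icc 0 ℓ | g τ ∈ range G.point} with hemp | hne
  · obtain ⟨e', σ, c, hσ, h⟩ := G.exists_param_eq_of_Icc hℓ hg fun τ hτ hr =>
      (hemp ▸ (⟨Ioo_subset_Icc_self hτ, hr⟩ : τ ∈ {τ ∈ Icc 0 ℓ | g τ ∈ range G.point}) :
        τ ∈ (∅ : Set ℝ))
    obtain ⟨rfl, rfl⟩ := hstart hℓ h
    exact ⟨σ, hσ, fun τ hτ _ => (h τ hτ).2⟩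
  · obtain ⟨τ₁, hτ₁, hmin⟩ := hfin.exists_minimal hne
    have hpos : 0 < τ₁ := lt_of_le_of_ne hτ₁.1.1 (by
      rintro rfl
      exact G.param_not_mem_range hu (h0 ▸ hτ₁.2))
    obtain ⟨e', σ, c, hσ, h⟩ := G.exists_param_eq_of_Icc hpos
      (hg.mono (Icc_subset_Icc le_rfl hτ₁.1.2)) fun τ hτ hr =>
        hτ.2.not_ge (hmin ⟨⟨hτ.1.le, hτ.2.le.trans hτ₁.1.2⟩, hr⟩ hτ.2.le)
    obtain ⟨rfl, rfl⟩ := hstart hpos h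
    refine ⟨σ, hσ, fun τ hτ hm => (h τ ⟨hτ.1, ?_⟩).2⟩
    -- At the first vertex time `τ₁` the parameter is already an end of the edge, so any later time
    -- would put `c + σ * τ` outside `[0, len]`.
    by_contra! hlt
    obtain ⟨h1, h2⟩ := h τ₁ (right_mem_Icc.2 hpos.le)
    have h3 : c + σ * τ₁ ∉ Ioo 0 (G.len e') := fun hI => G.param_not_mem_range hI (h2 ▸ hτ₁.2)
    refine h3 ?_
    rcases hσ with rfl | rfl
    · exact ⟨by linarith [hu.1], by linarith [hm.2]⟩
    · exact ⟨by linarith [hm.1], by linarith [hu.2]⟩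

end MetricGraph

/-! ### Connected subsets of metric annuli in a metric graph -/

namespace MetricGraph

variable {Y : Type*} [MetricSpace Y] (G : MetricGraph Y)

/-- An arc of an edge inside an annulus of width `w` has length at most `2 * w`. -/
theorem arc_length_le {ρ : Y} {h w : ℝ} (hh : 0 < h) (hw : 0 ≤ w) {e : G.E} {s t : ℝ} (hs : 0 ≤ s)
    (ht : t ≤ G.len e) (harc : ∀ u ∈ Icc s t, dist ρ (G.param e u) ∈ Icc h (h + w)) :
    t - s ≤ 2 * w := by
  -- The segment from the midpoint to `ρ` follows the edge in one direction. It either loses more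
  -- than `w` of distance within the arc, or reaches `ρ` within it; `0 < h` excludes the latter.
  by_contra! hlt
  have hu : (s + t) / 2 ∈ Ioo 0 (G.len e) := ⟨by linarith, by linarith⟩
  have hus : (s + t) / 2 ∈ Icc s t := ⟨by linarith, by linarith⟩
  have := G.geodesic
  obtain ⟨g, h0, h1, hg⟩ := GeodesicSpace.exists_isometricOn (G.param e ((s + t) / 2)) ρ
  set f := dist (G.param e ((s + t) / 2)) ρ with hf
  have hfm : f ∈ Icc h (h + w) := by rw [hf, dist_comm]; exact harc _ hus
  have hfpos : 0 < f := hh.trans_le hfm.1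
  obtain ⟨σ, hσ, hfol⟩ := G.exists_follow hu hfpos hg h0
  have hin : ∀ τ, 0 ≤ τ → τ ≤ (t - s) / 2 → (s + t) / 2 + σ * τ ∈ Icc s t := by
    intro τ h1 h2
    rcases hσ with rfl | rfl
    · exact ⟨by linarith, by linarith⟩
    · exact ⟨by linarith, by linarith⟩
  rcases le_or_gt ((t - s) / 2) f with hle | hgt
  · have hm := hin ((t - s) / 2) (by linarith) le_rfl
    have hτ : (t - s) / 2 ∈ Icc 0 f := ⟨by linarith, hle⟩
    have h2 := harc _ hm
    rw [← hfol _ hτ ⟨hs.trans hm.1, hm.2.trans ht⟩, ← h1,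
      hg f (right_mem_Icc.2 hfpos.le) _ hτ, abs_of_nonneg (by linarith)] at h2
    linarith [h2.1, hfm.2]
  · have hm := hin f hfpos.le hgt.le
    have h2 := harc _ hm
    rw [← hfol f (right_mem_Icc.2 hfpos.le) ⟨hs.trans hm.1, hm.2.trans ht⟩, h1, dist_self] at h2
    linarith [h2.1]

/-- A connected set that meets an arc of an edge but not its endpoints is contained in the arc. -/
theorem subset_arc_of_isPreconnected {K : Set Y} (hK : IsPreconnected K) {e : G.E} {c₁ s c₂ : ℝ}
    (h₁ : 0 ≤ c₁) (h₂ : c₂ ≤ G.len e) (hs : s ∈ Icc c₁ c₂) (hsK : G.param e s ∈ K)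
    (hc₁ : G.param e c₁ ∉ K) (hc₂ : G.param e c₂ ∉ K) : K ⊆ G.param e '' Ioo c₁ c₂ := by
  have hs' : s ∈ Ioo c₁ c₂ :=
    ⟨lt_of_le_of_ne hs.1 (by rintro rfl; exact hc₁ hsK),
      lt_of_le_of_ne hs.2 (by rintro rfl; exact hc₂ hsK)⟩
  refine hK.subset_left_of_subset_union (v := (G.param e '' Icc c₁ c₂)ᶜ)
    (G.isOpen_param_image e h₁ h₂) (G.isClosed_param_image e h₁ h₂).isOpen_compl ?_ ?_
    ⟨_, hsK, s, hs', rfl⟩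
  · exact disjoint_compl_right.mono_left (image_mono Ioo_subset_Icc_self)
  · intro y hy
    by_cases hm : y ∈ G.param e '' Icc c₁ c₂
    · obtain ⟨u, hu, rfl⟩ := hm
      refine Or.inl ⟨u, ⟨lt_of_le_of_ne hu.1 ?_, lt_of_le_of_ne hu.2 ?_⟩, rfl⟩
      · rintro rfl; exact hc₁ hy
      · rintro rfl; exact hc₂ hy
    · exact Or.inr hm

/-- The closed set made of the vertices in `C` and of the parts of the edges on the side of `C`,
when every edge `e` is cut at the parameter `c e`. -/
def sideSet (C : Set G.V) (c : G.E → ℝ) : Set Y :=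
  G.point '' C ∪ ⋃ e, ((⋃ _ : G.src e ∈ C, G.param e '' Icc 0 (c e)) ∪
    ⋃ _ : G.tgt e ∈ C, G.param e '' Icc (c e) (G.len e))

theorem isClosed_sideSet (C : Set G.V) {c : G.E → ℝ} (hc : ∀ e, c e ∈ Icc 0 (G.len e)) :
    IsClosed (G.sideSet C c) := by
  refine ((toFinite C).image _).isClosed.union (isClosed_iUnion_of_finite fun e =>
    (isClosed_iUnion_of_finite fun _ => ?_).union (isClosed_iUnion_of_finite fun _ => ?_))
  · exact G.isClosed_param_image e le_rfl (hc e).2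
  · exact G.isClosed_param_image e (hc e).1 le_rfl

theorem mem_sideSet_iff {C : Set G.V} {c : G.E → ℝ} {y : Y} :
    y ∈ G.sideSet C c ↔ (∃ v ∈ C, G.point v = y) ∨ ∃ e s, G.param e s = y ∧
      ((G.src e ∈ C ∧ s ∈ Icc 0 (c e)) ∨ (G.tgt e ∈ C ∧ s ∈ Icc (c e) (G.len e))) := by
  simp only [sideSet, mem_union, mem_image, mem_iUnion, exists_prop]
  refine or_congr Iff.rfl ⟨?_, ?_⟩
  · rintro ⟨e, ⟨h, s, hs, rfl⟩ | ⟨h, s, hs, rfl⟩⟩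
    · exact ⟨e, s, rfl, Or.inl ⟨h, hs⟩⟩
    · exact ⟨e, s, rfl, Or.inr ⟨h, hs⟩⟩
  · rintro ⟨e, s, rfl, ⟨h, hs⟩ | ⟨h, hs⟩⟩
    · exact ⟨e, Or.inl ⟨h, s, hs, rfl⟩⟩
    · exact ⟨e, Or.inr ⟨h, s, hs, rfl⟩⟩

/-- A set of vertices that is closed under the edges contained in a connected set `K` contains all
vertices of `K` if it contains one. -/
theorem mem_of_isPreconnected {K : Set Y} (hK : IsPreconnected K) {C : Set G.V}
    (hC : ∀ e, (∀ s ∈ Icc 0 (G.len e), G.param e s ∈ K) → (G.src e ∈ C ↔ G.tgt e ∈ C)) {v v' : G.V}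
    (hv : G.point v ∈ K) (hv' : G.point v' ∈ K) (hvC : v ∈ C) : v' ∈ C := by
  by_contra hvC'
  -- An edge between `C` and its complement is not contained in `K`, so it can be cut at a point
  -- outside `K`. Cutting there separates the two sides within `K`.
  have hcut : ∀ e, ∃ c ∈ Icc 0 (G.len e), (G.src e ∈ C ↔ G.tgt e ∈ C) ∨ G.param e c ∉ K := by
    intro e
    by_cases h : ∀ s ∈ Icc 0 (G.len e), G.param e s ∈ K
    · exact ⟨0, left_mem_Icc.2 (G.len_pos e).le, Or.inl (hC e h)⟩
    · push Not at h
      obtain ⟨c, hc, hcK⟩ := h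
      exact ⟨c, hc, Or.inr hcK⟩
  choose c hc hcK using hcut
  have hvert : ∀ C' : Set G.V, (∀ e, (G.src e ∈ C' ↔ G.tgt e ∈ C') ∨ G.param e (c e) ∉ K) →
      ∀ u, G.point u ∈ K → G.point u ∈ G.sideSet C' c → u ∈ C' := by
    intro C' hC' u huK hu
    rcases (G.mem_sideSet_iff).1 hu with ⟨u', hu', h⟩ | ⟨e, s, h, h'⟩
    · exact G.point_injective h ▸ hu'
    have hsI : s ∈ Icc 0 (G.len e) := by
      rcases h' with ⟨_, h'⟩ | ⟨_, h'⟩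
      · exact ⟨h'.1, h'.2.trans (hc e).2⟩
      · exact ⟨(hc e).1.trans h'.1, h'.2⟩
    have hends : s = 0 ∨ s = G.len e := by
      by_contra! hne
      exact G.param_ne_point e s
        ⟨lt_of_le_of_ne hsI.1 hne.1.symm, lt_of_le_of_ne hsI.2 hne.2⟩ u h
    rcases hends with rfl | rfl
    · have hu' : G.src e = u := G.point_injective (by rw [← G.param_zero, h])
      subst hu'
      rcases h' with ⟨h', _⟩ | ⟨h', hs⟩
      · exact h'
      · rcases hC' e with h1 | h1
        · exact h1.2 h'
        · rw [le_antisymm hs.1 (hc e).1, h] at h1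
          exact absurd huK h1
    · have hu' : G.tgt e = u := G.point_injective (by rw [← G.param_len, h])
      subst hu'
      rcases h' with ⟨h', hs⟩ | ⟨h', _⟩
      · rcases hC' e with h1 | h1
        · exact h1.1 h'
        · rw [le_antisymm (hc e).2 hs.2, h] at h1
          exact absurd huK h1
      · exact h'
  have hcover : K ⊆ G.sideSet C c ∪ G.sideSet Cᶜ c := by
    intro y _
    rcases G.covers y with ⟨u, rfl⟩ | ⟨e, s, hs, rfl⟩
    · by_cases hu : u ∈ C
      · exact Or.inl ((G.mem_sideSet_iff).2 (Or.inl ⟨u, hu, rfl⟩))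
      · exact Or.inr ((G.mem_sideSet_iff).2 (Or.inl ⟨u, hu, rfl⟩))
    · rcases le_total s (c e) with h | h
      · by_cases hu : G.src e ∈ C
        · exact Or.inl ((G.mem_sideSet_iff).2 (Or.inr ⟨e, s, rfl, Or.inl ⟨hu, hs.1.le, h⟩⟩))
        · exact Or.inr ((G.mem_sideSet_iff).2 (Or.inr ⟨e, s, rfl, Or.inl ⟨hu, hs.1.le, h⟩⟩))
      · by_cases hu : G.tgt e ∈ C
        · exact Or.inl ((G.mem_sideSet_iff).2 (Or.inr ⟨e, s, rfl, Or.inr ⟨hu, h, hs.2.le⟩⟩))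
        · exact Or.inr ((G.mem_sideSet_iff).2 (Or.inr ⟨e, s, rfl, Or.inr ⟨hu, h, hs.2.le⟩⟩))
  -- By connectedness the two closed sides meet in `K`. A common vertex would belong to `C` and to
  -- its complement, and a common interior point would be the cut point of an edge joining `C` to
  -- its complement, which is not in `K`.
  obtain ⟨y, hyK, hy, hy'⟩ := isPreconnected_closed_iff.1 hK _ _ (G.isClosed_sideSet C hc)
    (G.isClosed_sideSet Cᶜ hc) hcover ⟨_, hv, (G.mem_sideSet_iff).2 (Or.inl ⟨v, hvC, rfl⟩)⟩
    ⟨_, hv', (G.mem_sideSet_iff).2 (Or.inl ⟨v', hvC', rfl⟩)⟩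
  have hcK' : ∀ e, (G.src e ∈ Cᶜ ↔ G.tgt e ∈ Cᶜ) ∨ G.param e (c e) ∉ K := fun e =>
    (hcK e).imp_left not_congr
  by_cases hyV : y ∈ range G.point
  · obtain ⟨u, rfl⟩ := hyV
    exact hvert Cᶜ hcK' u hyK hy' (hvert C hcK u hyK hy)
  · obtain ⟨e, s, hs, rfl⟩ := G.exists_param_of_not_mem_range hyV
    have hrep : ∀ C' : Set G.V, G.param e s ∈ G.sideSet C' c →
        (G.src e ∈ C' ∧ s ≤ c e) ∨ (G.tgt e ∈ C' ∧ c e ≤ s) := by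
      intro C' h
      rcases (G.mem_sideSet_iff).1 h with ⟨u, _, hu⟩ | ⟨e', s', h, h'⟩
      · exact absurd ⟨u, hu⟩ hyV
      have hsI : s' ∈ Icc 0 (G.len e') := by
        rcases h' with ⟨_, h'⟩ | ⟨_, h'⟩
        · exact ⟨h'.1, h'.2.trans (hc e').2⟩
        · exact ⟨(hc e').1.trans h'.1, h'.2⟩
      obtain ⟨rfl, rfl⟩ := G.eq_of_param_eq hs hsI h.symm
      exact h'.imp (fun h => ⟨h.1, h.2.2⟩) (fun h => ⟨h.1, h.2.1⟩)
    rcases hrep C hy with ⟨h1, h2⟩ | ⟨h1, h2⟩ <;> rcases hrep Cᶜ hy' with ⟨h3, h4⟩ | ⟨h3, h4⟩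
    · exact h3 h1
    · rcases hcK e with h | h
      · exact h3 (h.1 h1)
      · exact h (le_antisymm h2 h4 ▸ hyK)
    · rcases hcK e with h | h
      · exact h3 (h.2 h1)
      · exact h (le_antisymm h4 h2 ▸ hyK)
    · exact h3 h1

/-- The simple graph on the vertices whose edges are spanned by the edges of length at most `L`. -/
def shortGraph (L : ℝ) : SimpleGraph G.V where
  Adj v v' := v ≠ v' ∧ ∃ e, G.len e ≤ L ∧ s(G.src e, G.tgt e) = s(v, v')
  symm := ⟨fun _ _ ⟨h, e, he, h'⟩ => ⟨h.symm, e, he, h'.trans Sym2.eq_swap⟩⟩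
  loopless := ⟨fun _ h => h.1 rfl⟩

theorem dist_point_le_of_walk {L : ℝ} {v v' : G.V} (p : (G.shortGraph L).Walk v v') :
    dist (G.point v) (G.point v') ≤ p.length * L := by
  induction p with
  | nil => simp
  | @cons u v w h p ih =>
    obtain ⟨e, he, h'⟩ := h.2
    have hd : dist (G.param e 0) (G.param e (G.len e)) ≤ L := by
      refine (G.dist_param_le e (left_mem_Icc.2 (G.len_pos e).le)
        (right_mem_Icc.2 (G.len_pos e).le)).trans ?_
      rwa [zero_sub, abs_neg, abs_of_pos (G.len_pos e)]
    rw [G.param_zero, G.param_len] at hd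
    have hd' : dist (G.point u) (G.point v) ≤ L := by
      rcases Sym2.eq_iff.1 h' with ⟨rfl, rfl⟩ | ⟨rfl, rfl⟩
      · exact hd
      · rwa [dist_comm]
    rw [SimpleGraph.Walk.length_cons]
    push_cast
    linarith [dist_triangle (G.point u) (G.point v) (G.point w)]

/-- A simple path repeats no edge, so it has at most as many steps as there are short edges. -/
theorem dist_point_le_of_reachable {L : ℝ} (hL : 0 ≤ L) {v v' : G.V}
    (h : (G.shortGraph L).Reachable v v') :
    dist (G.point v) (G.point v') ≤ G.edgeCount L * L := by
  classical
  obtain ⟨p, hp⟩ := h.exists_isPath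
  refine (G.dist_point_le_of_walk p).trans (mul_le_mul_of_nonneg_right ?_ hL)
  have hsub : p.edges.toFinset ⊆
      Finset.univ.image fun e : {e : G.E // G.len e ≤ L} => s(G.src e.1, G.tgt e.1) := by
    intro x hx
    have hx' := p.edges_subset_edgeSet (List.mem_toFinset.1 hx)
    induction x with
    | h a b =>
      obtain ⟨_, e, he, h'⟩ := hx'
      exact Finset.mem_image.2 ⟨⟨e, he⟩, Finset.mem_univ _, h'⟩
  have hcard := (Finset.card_le_card hsub).trans Finset.card_image_le
  rw [List.toFinset_card_of_nodup hp.isTrail.edges_nodup, SimpleGraph.Walk.length_edges,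
    Finset.card_univ, ← Nat.card_eq_fintype_card] at hcard
  exact_mod_cast hcard

theorem joinedIn_param {S : Set Y} {e : G.E} {s t : ℝ} (hs : s ∈ Icc 0 (G.len e))
    (ht : t ∈ Icc 0 (G.len e)) (h : ∀ u ∈ uIcc s t, G.param e u ∈ S) :
    JoinedIn S (G.param e s) (G.param e t) := by
  have hp : IsPathConnected (G.param e '' uIcc s t) :=
    ((convex_uIcc s t).isPathConnected nonempty_uIcc).image'
      ((G.continuousOn_param e).mono (uIcc_subset_Icc hs ht))
  refine (hp.joinedIn _ (mem_image_of_mem _ left_mem_uIcc) _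
    (mem_image_of_mem _ right_mem_uIcc)).mono ?_
  rintro _ ⟨u, hu, rfl⟩
  exact h u hu

/-- Inside an edge, one can move from `p` either way. If one direction reaches an end without
leaving the annulus, that end is the vertex. Otherwise points outside the annulus on both sides trap
the path in the edge, and `q` lies on a common arc. In each case `arc_length_le` bounds the arc. -/
theorem exists_vertex_or_dist_le {ρ : Y} {h w : ℝ} (hh : 0 < h) (hw : 0 ≤ w) {p q : Y}
    (hpq : JoinedIn {z | dist ρ z ∈ Icc h (h + w)} p q) :
    (∃ v, JoinedIn {z | dist ρ z ∈ Icc h (h + w)} p (G.point v) ∧ dist p (G.point v) ≤ 2 * w) ∨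
      dist p q ≤ 2 * w := by
  set S : Set Y := {z | dist ρ z ∈ Icc h (h + w)} with hS
  rcases G.covers p with ⟨v, rfl⟩ | ⟨e, s, hs, rfl⟩
  · exact Or.inl ⟨v, JoinedIn.refl hpq.source_mem, by rw [dist_self]; linarith⟩
  have hsI := Ioo_subset_Icc_self hs
  have hlen := (G.len_pos e).le
  by_cases hl : ∀ u ∈ Icc 0 s, G.param e u ∈ S
  · refine Or.inl ⟨G.src e, ?_, ?_⟩ <;> rw [← G.param_zero]
    · exact G.joinedIn_param hsI (left_mem_Icc.2 hlen) (by rwa [uIcc_of_ge hs.1.le])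
    · refine (G.dist_param_le e hsI (left_mem_Icc.2 hlen)).trans ?_
      rw [abs_of_nonneg (by linarith [hs.1])]
      exact G.arc_length_le hh hw le_rfl hs.2.le hl
  by_cases hr : ∀ u ∈ Icc s (G.len e), G.param e u ∈ S
  · refine Or.inl ⟨G.tgt e, ?_, ?_⟩ <;> rw [← G.param_len]
    · exact G.joinedIn_param hsI (right_mem_Icc.2 hlen) (by rwa [uIcc_of_le hs.2.le])
    · refine (G.dist_param_le e hsI (right_mem_Icc.2 hlen)).trans ?_
      rw [abs_sub_comm, abs_of_nonneg (by linarith [hs.2])]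
      exact G.arc_length_le hh hw hs.1.le le_rfl hr
  right
  push Not at hl hr
  obtain ⟨c₁, hc₁, hc₁S⟩ := hl
  obtain ⟨c₂, hc₂, hc₂S⟩ := hr
  obtain ⟨γ, hγ⟩ := hpq
  have hKS : range γ ⊆ S := by rintro _ ⟨t, rfl⟩; exact hγ t
  have hK : IsPreconnected (range γ) := isPreconnected_range γ.continuous
  have hpK : G.param e s ∈ range γ := ⟨0, γ.source⟩
  have hqK : q ∈ range γ := ⟨1, γ.target⟩
  have hc : ∀ {c}, G.param e c ∉ S → G.param e c ∉ range γ := fun h h' => h (hKS h')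
  obtain ⟨s', hs', rfl⟩ := G.subset_arc_of_isPreconnected hK hc₁.1 hc₂.2 ⟨hc₁.2, hc₂.1⟩ hpK
    (hc hc₁S) (hc hc₂S) hqK
  have hs'I : s' ∈ Ioo 0 (G.len e) := ⟨hc₁.1.trans_lt hs'.1, hs'.2.trans_le hc₂.2⟩
  have hbetween : ∀ u ∈ uIcc s s', G.param e u ∈ S := by
    intro u hu
    by_contra huS
    rcases le_total s s' with hle | hle
    · rw [uIcc_of_le hle] at hu
      obtain ⟨s'', hs'', h''⟩ := G.subset_arc_of_isPreconnected hK hc₁.1 (hu.2.trans hs'I.2.le)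
        ⟨hc₁.2, hu.1⟩ hpK (hc hc₁S) (hc huS) hqK
      have := (G.eq_of_param_eq hs'I ⟨hc₁.1.trans hs''.1.le, hs''.2.le.trans
        (hu.2.trans hs'I.2.le)⟩ h''.symm).2
      linarith [hs''.2, hu.2]
    · rw [uIcc_of_ge hle] at hu
      obtain ⟨s'', hs'', h''⟩ := G.subset_arc_of_isPreconnected hK (hs'I.1.le.trans hu.1) hc₂.2
        ⟨hu.2, hc₂.1⟩ hpK (hc huS) (hc hc₂S) hqK
      have := (G.eq_of_param_eq hs'I ⟨(hs'I.1.le.trans hu.1).trans hs''.1.le, hs''.2.le.trans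
        hc₂.2⟩ h''.symm).2
      linarith [hs''.1, hu.1]
  refine (G.dist_param_le e hsI (Ioo_subset_Icc_self hs'I)).trans ?_
  rcases le_total s s' with hle | hle
  · rw [abs_sub_comm, abs_of_nonneg (by linarith)]
    exact G.arc_length_le hh hw hsI.1 hs'I.2.le (by rwa [uIcc_of_le hle] at hbetween)
  · rw [abs_of_nonneg (by linarith)]
    exact G.arc_length_le hh hw hs'I.1.le hsI.2 (by rwa [uIcc_of_ge hle] at hbetween)

/-- The diameter of a path component of an annulus of width `w` is bounded in terms of the number
of edges of length at most `2 * w`. -/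
theorem dist_le_of_joinedIn_annulus {ρ : Y} {h w : ℝ} (hw : 0 ≤ w) {p q : Y}
    (hpq : JoinedIn {z | dist ρ z ∈ Icc h (h + w)} p q) :
    dist p q ≤ 2 * w * (2 + G.edgeCount (2 * w)) := by
  have hN : (0 : ℝ) ≤ G.edgeCount (2 * w) := Nat.cast_nonneg _
  have hmul : 0 ≤ w * G.edgeCount (2 * w) := mul_nonneg hw hN
  -- For `h ≤ 0` the annulus lies in the ball of radius `w`, and `arc_length_le` is not available.
  rcases le_or_gt h 0 with hh | hh
  · have h1 : dist ρ p ∈ Icc h (h + w) := hpq.source_mem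
    have h2 : dist ρ q ∈ Icc h (h + w) := hpq.target_mem
    nlinarith [dist_triangle_left p q ρ, h1.2, h2.2]
  rcases G.exists_vertex_or_dist_le hh hw hpq with ⟨v, hv, hpv⟩ | hd
  swap
  · nlinarith
  rcases G.exists_vertex_or_dist_le hh hw hpq.symm with ⟨v', hv', hqv⟩ | hd
  swap
  · rw [dist_comm] at hd; nlinarith
  obtain ⟨γ, hγ⟩ := (hv.symm.trans hpq).trans hv'
  -- Edges contained in the annulus have length at most `2 * w`, so reachability through short edges
  -- is closed under them.
  have hreach : v' ∈ {u | (G.shortGraph (2 * w)).Reachable v u} := by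
    refine G.mem_of_isPreconnected (isPreconnected_range γ.continuous) (fun e he => ?_)
      ⟨0, γ.source⟩ ⟨1, γ.target⟩ (SimpleGraph.Reachable.refl v)
    by_cases hst : G.src e = G.tgt e
    · rw [hst]
    have hle : G.len e - 0 ≤ 2 * w := G.arc_length_le hh hw le_rfl le_rfl fun u hu => by
      obtain ⟨t, ht⟩ := he u hu
      have := hγ t
      rw [ht] at this
      exact this
    have hadj : (G.shortGraph (2 * w)).Adj (G.src e) (G.tgt e) := ⟨hst, e, by linarith, rfl⟩
    exact ⟨fun h => h.trans hadj.reachable, fun h => h.trans hadj.symm.reachable⟩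
  have hvv := G.dist_point_le_of_reachable (by linarith) hreach
  have h1 := dist_triangle4 p (G.point v) (G.point v') q
  rw [dist_comm (G.point v') q] at h1
  nlinarith

end MetricGraph

/-! ### Branch points of the distance function and the first Betti number -/

/-- `z` is a branch point of the distance from `ρ`: there are two segments that start at `z`, run
straight towards `ρ`, and do not agree near `z`. -/
def IsBranchPoint {Y : Type*} [MetricSpace Y] (ρ z : Y) : Prop :=
  ∃ (g g' : ℝ → Y) (η : ℝ), 0 < η ∧ IsometricOn g (Icc 0 η) ∧ IsometricOn g' (Icc 0 η) ∧
    g 0 = z ∧ g' 0 = z ∧ (∀ u ∈ Icc 0 η, dist ρ (g u) = dist ρ z - u) ∧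
    (∀ u ∈ Icc 0 η, dist ρ (g' u) = dist ρ z - u) ∧ ¬ ∃ η' > 0, EqOn g g' (Icc 0 η')

namespace MetricGraph

variable {Y : Type*} [MetricSpace Y] (G : MetricGraph Y)

/-- Every boundary has coordinate sum zero, so the rank of the boundary map is less than the number
of vertices; rank-nullity gives the rest. -/
theorem card_edges_lt [Nonempty G.V] :
    Fintype.card G.E < G.betti1 + Fintype.card G.V := by
  classical
  have hsum : ∀ f : G.E → ℚ, ∑ v, G.boundary f v = 0 := by
    intro f
    simp only [boundary, Fintype.linearCombination_apply, Finset.sum_apply, Pi.smul_apply,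
      Pi.sub_apply, smul_eq_mul]
    rw [Finset.sum_comm]
    refine Finset.sum_eq_zero fun e _ => ?_
    rw [← Finset.mul_sum, Finset.sum_sub_distrib]
    simp [Pi.single_apply]
  have hne : LinearMap.range G.boundary ≠ ⊤ := by
    intro h
    obtain ⟨v⟩ := ‹Nonempty G.V›
    obtain ⟨f, hf⟩ := LinearMap.range_eq_top.1 h (Pi.single v 1)
    have := hsum f
    rw [hf] at this
    simp [Pi.single_apply] at this
  have h1 := Submodule.finrank_lt hne
  have h2 := LinearMap.finrank_range_add_finrank_ker G.boundary
  rw [Module.finrank_fintype_fun_eq_card] at h1 h2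
  rw [betti1]
  omega

/-- The distance from `ρ` decreases with unit speed along `e` from the parameter `s` in the
direction `σ`. -/
def Descends (ρ : Y) (e : G.E) (σ s : ℝ) : Prop :=
  ∃ η > 0, ∀ u ∈ Icc 0 η, s + σ * u ∈ Icc 0 (G.len e) ∧
    dist ρ (G.param e (s + σ * u)) = dist ρ (G.param e s) - u

/-- The distance from `ρ` decreases in all directions along the edge `x.1` from the parameter
`x.2`. -/
def IsPeak (ρ : Y) (x : G.E × ℝ) : Prop :=
  x.2 ∈ Icc 0 (G.len x.1) ∧ (x.2 < G.len x.1 → G.Descends ρ x.1 1 x.2) ∧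
    (0 < x.2 → G.Descends ρ x.1 (-1) x.2)

/-- The distance to `ρ` attains its minimum strictly between two peaks. At an interior point of an
edge other than `ρ` it decreases along the edge in some direction, so the minimum is `ρ` itself. -/
theorem exists_param_eq_root {ρ : Y} {e : G.E} {s s' : ℝ} (hs : G.IsPeak ρ (e, s))
    (hs' : G.IsPeak ρ (e, s')) (hlt : s < s') : ∃ t ∈ Ioo s s', G.param e t = ρ := by
  have hsub : Icc s s' ⊆ Icc 0 (G.len e) := Icc_subset_Icc hs.1.1 hs'.1.2
  have hcont : ContinuousOn (fun t => dist ρ (G.param e t)) (Icc s s') :=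
    (continuous_const.dist continuous_id).comp_continuousOn ((G.continuousOn_param e).mono hsub)
  obtain ⟨t, ht, hmin⟩ := isCompact_Icc.exists_isMinOn (nonempty_Icc.2 hlt.le) hcont
  have hts : t ≠ s := by
    rintro rfl
    obtain ⟨η, hη, h⟩ := hs.2.1 (hlt.trans_le hs'.1.2)
    have hu : 0 < min η (s' - t) := lt_min hη (sub_pos.2 hlt)
    have h1 := (h _ ⟨hu.le, min_le_left _ _⟩).2
    have h2 : dist ρ (G.param e t) ≤ dist ρ (G.param e (t + 1 * min η (s' - t))) :=
      hmin ⟨by linarith, by linarith [min_le_right η (s' - t)]⟩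
    simp only at h1
    linarith
  have hts' : t ≠ s' := by
    rintro rfl
    obtain ⟨η, hη, h⟩ := hs'.2.2 (hs.1.1.trans_lt hlt)
    have hu : 0 < min η (t - s) := lt_min hη (sub_pos.2 hlt)
    have h1 := (h _ ⟨hu.le, min_le_left _ _⟩).2
    have h2 : dist ρ (G.param e t) ≤ dist ρ (G.param e (t + -1 * min η (t - s))) :=
      hmin ⟨by linarith [min_le_right η (t - s)], by linarith⟩
    simp only at h1
    linarith
  have htI : t ∈ Ioo s s' := ⟨lt_of_le_of_ne ht.1 hts.symm, lt_of_le_of_ne ht.2 hts'⟩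
  refine ⟨t, htI, ?_⟩
  by_contra hne
  have := G.geodesic
  obtain ⟨g, h0, h1, hg⟩ := GeodesicSpace.exists_isometricOn (G.param e t) ρ
  set f := dist (G.param e t) ρ with hf
  have hfpos : 0 < f := dist_pos.2 hne
  obtain ⟨σ, hσ, hfol⟩ := G.exists_follow ⟨hs.1.1.trans_lt htI.1, htI.2.trans_le hs'.1.2⟩ hfpos hg h0
  set τ := min f (min (t - s) (s' - t)) with hτ
  have hτpos : 0 < τ := lt_min hfpos (lt_min (sub_pos.2 htI.1) (sub_pos.2 htI.2))
  have hτf : τ ≤ f := min_le_left _ _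
  have hτ1 : τ ≤ t - s := (min_le_right _ _).trans (min_le_left _ _)
  have hτ2 : τ ≤ s' - t := (min_le_right _ _).trans (min_le_right _ _)
  have hm : t + σ * τ ∈ Icc s s' := by
    rcases hσ with rfl | rfl
    · exact ⟨by linarith, by linarith⟩
    · exact ⟨by linarith, by linarith⟩
  have h2 : dist ρ (G.param e t) ≤ dist ρ (G.param e (t + σ * τ)) := hmin hm
  rw [← hfol τ ⟨hτpos.le, hτf⟩ (hsub hm), dist_comm, ← hf, ← h1,
    hg f (right_mem_Icc.2 hfpos.le) _ ⟨hτpos.le, hτf⟩, abs_of_nonneg (by linarith)] at h2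
  linarith

/-- A segment that runs straight towards `ρ` starts along an edge. -/
theorem exists_descends {ρ z : Y} {g : ℝ → Y} {η : ℝ} (hη : 0 < η) (hg : IsometricOn g (Icc 0 η))
    (h0 : g 0 = z) (hd : ∀ u ∈ Icc 0 η, dist ρ (g u) = dist ρ z - u) :
    ∃ e, ∃ σ s : ℝ, (σ = 1 ∨ σ = -1) ∧ s ∈ Icc 0 (G.len e) ∧ G.param e s = z ∧
      G.Descends ρ e σ s ∧ ∃ η' > 0, EqOn g (fun u => G.param e (s + σ * u)) (Icc 0 η') := by
  obtain ⟨e, σ, s, η', hσ, hη', hle, h⟩ := G.exists_germ hη hg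
  obtain ⟨h1, h2⟩ := h 0 (left_mem_Icc.2 hη'.le)
  rw [mul_zero, add_zero] at h1 h2
  have hz : G.param e s = z := by rw [← h2, h0]
  refine ⟨e, σ, s, hσ, h1, hz, ⟨η', hη', fun u hu => ⟨(h u hu).1, ?_⟩⟩, η', hη', fun u hu =>
    (h u hu).2⟩
  rw [← (h u hu).2, hz]
  exact hd u ⟨hu.1, hu.2.trans hle⟩

/-- A descending direction at a vertex is determined by the edge and its end. -/
theorem isPeak_of_mem_range {ρ : Y} {e : G.E} {σ s : ℝ} (hσ : σ = 1 ∨ σ = -1)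
    (hs : s ∈ Icc 0 (G.len e)) (hv : G.param e s ∈ range G.point) (hd : G.Descends ρ e σ s) :
    G.IsPeak ρ (e, s) ∧ (s = 0 ∧ σ = 1 ∨ s = G.len e ∧ σ = -1) := by
  obtain ⟨η, hη, h⟩ := hd
  have hr := (h η (right_mem_Icc.2 hη.le)).1
  have hends : s = 0 ∨ s = G.len e := by
    by_contra! hne
    exact G.param_not_mem_range ⟨lt_of_le_of_ne hs.1 hne.1.symm, lt_of_le_of_ne hs.2 hne.2⟩ hv
  rcases hends with rfl | rfl <;> rcases hσ with rfl | rfl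
  · exact ⟨⟨hs, fun _ => ⟨η, hη, h⟩, fun h => absurd h (lt_irrefl _)⟩, Or.inl ⟨rfl, rfl⟩⟩
  · linarith [hr.1]
  · linarith [hr.2]
  · exact ⟨⟨hs, fun h => absurd h (lt_irrefl _), fun _ => ⟨η, hη, h⟩⟩, Or.inr ⟨rfl, rfl⟩⟩

/-- The first edge of a segment from the vertex to `ρ` has a peak at this end, since the edge has
only one direction there. -/
theorem exists_isPeak_of_vertex {ρ : Y} (v : G.V) (hv : G.point v ≠ ρ) :
    ∃ x, G.IsPeak ρ x ∧ G.param x.1 x.2 = G.point v := by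
  have := G.geodesic
  obtain ⟨g, h0, h1, hg⟩ := GeodesicSpace.exists_isometricOn (G.point v) ρ
  have hpos := dist_pos.2 hv
  obtain ⟨e, σ, s, hσ, hs, hz, hd, -⟩ := G.exists_descends (ρ := ρ) hpos hg h0 fun u hu => by
    have := hg _ (right_mem_Icc.2 hpos.le) u hu
    rw [h1, abs_of_nonneg (by linarith [hu.2])] at this
    rw [this, dist_comm ρ]
  exact ⟨(e, s), (G.isPeak_of_mem_range hσ hs ⟨v, hz.symm⟩ hd).1, hz⟩

/-- At a vertex the two descending germs use different edge ends, hence give two peaks, one more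
than every vertex other than `ρ` has. Inside an edge they are the two directions of that edge, and
the same peak serves twice. -/
theorem exists_isPeak_of_isBranchPoint {ρ z : Y} (hz : IsBranchPoint ρ z) :
    ∃ x x', G.IsPeak ρ x ∧ G.IsPeak ρ x' ∧ G.param x.1 x.2 = z ∧ G.param x'.1 x'.2 = z ∧
      (z ∈ range G.point → x ≠ x') := by
  obtain ⟨g, g', η, hη, hg, hg', h0, h0', hd, hd', hne⟩ := hz
  obtain ⟨e, σ, s, hσ, hs, hzs, hD, η₁, hη₁, heq⟩ := G.exists_descends hη hg h0 hd
  obtain ⟨e', σ', s', hσ', hs', hzs', hD', η₂, hη₂, heq'⟩ := G.exists_descends hη hg' h0' hd'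
  have hdist : ¬ (e = e' ∧ s = s' ∧ σ = σ') := by
    rintro ⟨rfl, rfl, rfl⟩
    exact hne ⟨min η₁ η₂, lt_min hη₁ hη₂, fun u hu =>
      (heq ⟨hu.1, hu.2.trans (min_le_left _ _)⟩).trans
        (heq' ⟨hu.1, hu.2.trans (min_le_right _ _)⟩).symm⟩
  by_cases hr : z ∈ range G.point
  · obtain ⟨hp, hc⟩ := G.isPeak_of_mem_range hσ hs (hzs ▸ hr) hD
    obtain ⟨hp', hc'⟩ := G.isPeak_of_mem_range hσ' hs' (hzs' ▸ hr) hD'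
    refine ⟨(e, s), (e', s'), hp, hp', hzs, hzs', fun _ h => hdist ?_⟩
    obtain ⟨rfl, rfl⟩ := Prod.mk.inj h
    have := G.len_pos e
    refine ⟨rfl, rfl, ?_⟩
    rcases hc with ⟨h1, rfl⟩ | ⟨h1, rfl⟩ <;> rcases hc' with ⟨h2, rfl⟩ | ⟨h2, rfl⟩
    · rfl
    · linarith
    · linarith
    · rfl
  · have hsI := G.mem_Ioo_of_not_mem_range hs (hzs ▸ hr)
    obtain ⟨rfl, rfl⟩ := G.eq_of_param_eq hsI hs' (hzs.trans hzs'.symm)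
    have hpk : G.IsPeak ρ (e, s) := by
      rcases hσ with rfl | rfl <;> rcases hσ' with rfl | rfl
      · exact absurd ⟨rfl, rfl, rfl⟩ hdist
      · exact ⟨hs, fun _ => hD, fun _ => hD'⟩
      · exact ⟨hs, fun _ => hD', fun _ => hD⟩
      · exact absurd ⟨rfl, rfl, rfl⟩ hdist
    exact ⟨(e, s), (e, s), hpk, hpk, hzs, hzs, fun h => absurd h hr⟩

open Classical in
/-- The edge of a peak, or `none` if the root precedes the peak on this edge. -/
noncomputable def peakCode (ρ : Y) (x : G.E × ℝ) : Option G.E :=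
  if ∃ t ∈ Ioo 0 x.2, G.param x.1 t = ρ then none else some x.1

/-- Two peaks on one edge have the root between them, so only the later one gets `none`. The root is
interior to at most one edge, so `none` is used at most once. -/
theorem peakCode_injOn (ρ : Y) : InjOn (G.peakCode ρ) {x | G.IsPeak ρ x} := by
  rintro ⟨e, s⟩ hx ⟨e', s'⟩ hx' h
  have key : ∀ {e s s'}, G.IsPeak ρ (e, s) → G.IsPeak ρ (e, s') →
      G.peakCode ρ (e, s) = G.peakCode ρ (e, s') → ¬ s < s' := by
    intro e s s' hp hp' h hlt
    obtain ⟨t, ht, hρ⟩ := G.exists_param_eq_root hp hp' hlt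
    have ht0 : t ∈ Ioo 0 s' := ⟨hp.1.1.trans_lt ht.1, ht.2⟩
    have h' : G.peakCode ρ (e, s') = none := if_pos ⟨t, ht0, hρ⟩
    rw [h', peakCode] at h
    split_ifs at h with hex
    obtain ⟨t', ht', hρ'⟩ := hex
    have := (G.param_injective e e t ⟨ht0.1, ht0.2.trans_le hp'.1.2⟩ t'
      ⟨ht'.1, ht'.2.trans_le hp.1.2⟩ (hρ.trans hρ'.symm)).2
    linarith [ht.1, ht'.2]
  have he : e = e' := by
    have h' := h
    unfold peakCode at h'
    split_ifs at h' with h1 h2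
    · obtain ⟨t, ht, hρ⟩ := h1
      obtain ⟨t', ht', hρ'⟩ := h2
      exact (G.param_injective e e' t ⟨ht.1, ht.2.trans_le hx.1.2⟩ t'
        ⟨ht'.1, ht'.2.trans_le hx'.1.2⟩ (hρ.trans hρ'.symm)).1
    · exact Option.some.inj h'
  subst he
  exact Prod.ext rfl (le_antisymm (not_lt.1 (key hx' hx h.symm)) (not_lt.1 (key hx hx' h)))

theorem nonempty_V (y : Y) : Nonempty G.V := by
  rcases G.covers y with ⟨v, _⟩ | ⟨e, _⟩
  · exact ⟨v⟩
  · exact ⟨G.src e⟩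

/-- The number of branch points of the distance from a point is at most the first Betti number. -/
theorem card_branchPoints_le (ρ : Y) (S : Finset Y) (hS : ∀ z ∈ S, IsBranchPoint ρ z) :
    S.card ≤ G.betti1 := by
  classical
  have := G.nonempty_V ρ
  choose P hP hPv using fun v : {v // G.point v ≠ ρ} => G.exists_isPeak_of_vertex v.1 v.2
  -- Each branch point supplies a peak that no vertex has claimed.
  have hQ : ∀ z : S, ∃ x, G.IsPeak ρ x ∧ G.param x.1 x.2 = z ∧ ∀ v, P v ≠ x := by
    intro z
    obtain ⟨x, x', hx, hx', hxz, hxz', hne⟩ := G.exists_isPeak_of_isBranchPoint (hS z z.2)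
    by_cases h : ∃ v, P v = x
    · obtain ⟨v, rfl⟩ := h
      have hvz : G.point v = z := (hPv v).symm.trans hxz
      refine ⟨x', hx', hxz', fun v' h' => hne ⟨v, hvz⟩ ?_⟩
      have : v' = v := Subtype.ext (G.point_injective (by rw [← hPv v', h', hxz', hvz]))
      rw [← this, h']
    · exact ⟨x, hx, hxz, fun v hv => h ⟨v, hv⟩⟩
  choose Q hQ hQz hPQ using hQ
  -- The value `none` is free for a vertex at `ρ`, because then no peak has code `none`. Injectivity
  -- gives `|V| + |S| ≤ |E| + 1`, and `card_edges_lt` gives `|E| + 1 ≤ β₁ + |V|`.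
  let F : G.V ⊕ S → Option G.E := Sum.elim
    (fun v => if h : G.point v = ρ then none else G.peakCode ρ (P ⟨v, h⟩))
    (fun z => G.peakCode ρ (Q z))
  have hroot : ∀ v, G.point v = ρ → ∀ x, G.IsPeak ρ x → G.peakCode ρ x ≠ none := by
    intro v hv x hx h
    unfold peakCode at h
    split_ifs at h with hex
    obtain ⟨t, ht, hρ⟩ := hex
    exact G.param_ne_point x.1 t ⟨ht.1, ht.2.trans_le hx.1.2⟩ v (hρ.trans hv.symm)
  have hinj := G.peakCode_injOn ρ
  have hF : Function.Injective F := by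
    rintro (v | z) (v' | z') h
    · simp only [F, Sum.elim_inl] at h
      congr 1
      split_ifs at h with h1 h2 h2
      · exact G.point_injective (h1.trans h2.symm)
      · exact absurd h.symm (hroot v h1 _ (hP _))
      · exact absurd h (hroot v' h2 _ (hP _))
      · have := hinj (hP _) (hP _) h
        exact G.point_injective (by rw [← hPv ⟨v, h1⟩, ← hPv ⟨v', h2⟩, this])
    · simp only [F, Sum.elim_inl, Sum.elim_inr] at h
      split_ifs at h with h1
      · exact absurd h.symm (hroot v h1 _ (hQ _))
      · exact absurd (hinj (hP _) (hQ _) h) (hPQ _ _)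
    · simp only [F, Sum.elim_inl, Sum.elim_inr] at h
      split_ifs at h with h1
      · exact absurd h (hroot v' h1 _ (hQ _))
      · exact absurd (hinj (hP _) (hQ _) h.symm) (hPQ _ _)
    · simp only [F, Sum.elim_inr] at h
      have := hinj (hQ _) (hQ _) h
      exact congrArg Sum.inr (Subtype.ext (by rw [← hQz z, ← hQz z', this]))
  have hcard := Fintype.card_le_of_injective F hF
  rw [Fintype.card_sum, Fintype.card_option, Fintype.card_coe] at hcard
  have := G.card_edges_lt
  omega

end MetricGraph

/-! ### Lifting segments of a metric graph -/

theorem IsometricOn.comp_add {Y : Type*} [MetricSpace Y] {g : ℝ → Y} {a b t : ℝ}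
    (h : IsometricOn g (Icc a b)) (ht : a ≤ t) :
    IsometricOn (fun u => g (t + u)) (Icc 0 (b - t)) := fun u hu u' hu' => by
  rw [h _ ⟨by linarith [hu.1], by linarith [hu.2]⟩ _ ⟨by linarith [hu'.1], by linarith [hu'.2]⟩]
  congr 1; ring

theorem IsometricOn.comp_sub {Y : Type*} [MetricSpace Y] {g : ℝ → Y} {a b t : ℝ}
    (h : IsometricOn g (Icc a b)) (ht : t ≤ b) :
    IsometricOn (fun u => g (t - u)) (Icc 0 (t - a)) := fun u hu u' hu' => by
  rw [h _ ⟨by linarith [hu.2], by linarith [hu.1]⟩ _ ⟨by linarith [hu'.2], by linarith [hu'.1]⟩,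
    abs_sub_comm]
  congr 1; ring

theorem IsometricOn.abs_dist_sub_le {Y : Type*} [MetricSpace Y] {g : ℝ → Y} {S : Set ℝ}
    (h : IsometricOn g S) (ρ : Y) {s t : ℝ} (hs : s ∈ S) (ht : t ∈ S) :
    |dist ρ (g s) - dist ρ (g t)| ≤ |s - t| := by
  rw [← h s hs t ht, dist_comm ρ, dist_comm ρ]
  exact _root_.abs_dist_sub_le _ _ _

namespace MetricGraph

variable {Y : Type*} [MetricSpace Y]

/-- The distance from a point has slope `1` or `-1` at the start of a segment. -/
theorem exists_slope (G : MetricGraph Y) {ρ : Y} {g : ℝ → Y} {ℓ : ℝ} (hℓ : 0 < ℓ)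
    (hg : IsometricOn g (Icc 0 ℓ)) : ∃ η > 0, η ≤ ℓ ∧ ((∀ u ∈ Icc 0 η, dist ρ (g u) = dist ρ (g 0) + u) ∨
      (∀ u ∈ Icc 0 η, dist ρ (g u) = dist ρ (g 0) - u)) := by
  obtain ⟨e, σ, c, η₀, hσ, hη₀, hle₀, h₀⟩ := G.exists_germ hℓ hg
  obtain ⟨η, hη, hle, hρ⟩ : ∃ η > 0, η ≤ η₀ ∧ ∀ u ∈ Ioo 0 η, g u ≠ ρ := by
    by_cases hex : ∃ u ∈ Ioc 0 η₀, g u = ρ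
    · obtain ⟨u, hu, rfl⟩ := hex
      refine ⟨u, hu.1, hu.2, fun u' hu' h => hu'.2.ne (hg.injOn ?_ ?_ h)⟩
      · exact ⟨hu'.1.le, hu'.2.le.trans (hu.2.trans hle₀)⟩
      · exact ⟨hu.1.le, hu.2.trans hle₀⟩
    · exact ⟨η₀, hη₀, le_rfl, fun u hu h => hex ⟨u, ⟨hu.1, hu.2.le⟩, h⟩⟩
  have hmem : ∀ {u}, u ∈ Icc 0 η → u ∈ Icc 0 ℓ := fun hu => ⟨hu.1, hu.2.trans (hle.trans hle₀)⟩
  have hpar : ∀ {u}, u ∈ Icc 0 η → c + σ * u ∈ Icc 0 (G.len e) ∧ g u = G.param e (c + σ * u) :=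
    fun hu => h₀ _ ⟨hu.1, hu.2.trans hle⟩
  have hopen : ∀ {u}, u ∈ Ioo 0 η → c + σ * u ∈ Ioo 0 (G.len e) := by
    intro u hu
    have h1 := (hpar (left_mem_Icc.2 hη.le)).1
    have h2 := (hpar (right_mem_Icc.2 hη.le)).1
    rcases hσ with rfl | rfl
    · exact ⟨by linarith [hu.1, h1.1], by linarith [hu.2, h2.2]⟩
    · exact ⟨by linarith [hu.2, h2.1], by linarith [hu.1, h1.2]⟩
  -- A segment from `g u` to `ρ` either runs back through `g 0` or forward along `g`. If it runs
  -- back for some `u`, the distance increases on `[0, u]`. If it never does, the distance decreases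
  -- on `(0, η)`, and also from `0` by continuity.
  have key : ∀ u ∈ Ioo 0 η, dist ρ (g 0) = dist ρ (g u) - u ∨
      ∀ u' ∈ Ioo u η, dist ρ (g u') = dist ρ (g u) - (u' - u) := by
    intro u hu
    have huI := Ioo_subset_Icc_self hu
    have := G.geodesic
    obtain ⟨k, k0, k1, hk⟩ := GeodesicSpace.exists_isometricOn (g u) ρ
    set f := dist (g u) ρ with hf
    have hfpos : 0 < f := dist_pos.2 (hρ u hu)
    have hkd : ∀ τ ∈ Icc 0 f, dist ρ (k τ) = f - τ := by
      intro τ hτ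
      have := hk _ (right_mem_Icc.2 hfpos.le) τ hτ
      rwa [k1, abs_of_nonneg (by linarith [hτ.2])] at this
    obtain ⟨σ', hσ', hfol⟩ := G.exists_follow (hopen hu) hfpos hk (k0.trans (hpar huI).2)
    rw [dist_comm ρ (g u), ← hf]
    by_cases hs : σ' = -σ
    · subst hs
      have hback : ∀ τ ∈ Icc 0 f, τ ≤ u → k τ = g (u - τ) := by
        intro τ hτ hτu
        have hm := hpar (u := u - τ) ⟨by linarith, by linarith [hτ.1, hu.2]⟩
        have he : c + σ * u + -σ * τ = c + σ * (u - τ) := by ring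
        rw [hfol τ hτ (by rw [he]; exact hm.1), he, hm.2]
      have hfu : u ≤ f := by
        by_contra! hlt
        have := hback f (right_mem_Icc.2 hfpos.le) hlt.le
        rw [k1] at this
        exact hρ (u - f) ⟨by linarith, by linarith [hu.2]⟩ this.symm
      have h1 := hback u ⟨hu.1.le, hfu⟩ le_rfl
      rw [sub_self] at h1
      left
      rw [← h1]
      exact hkd u ⟨hu.1.le, hfu⟩
    · have hs' : σ' = σ := by
        rcases hσ with rfl | rfl <;> rcases hσ' with rfl | rfl <;>
          first | rfl | exact absurd (by norm_num) hs
      subst hs'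
      have hforw : ∀ τ ∈ Icc 0 f, u + τ ≤ η → k τ = g (u + τ) := by
        intro τ hτ hτu
        have hm := hpar (u := u + τ) ⟨by linarith [hu.1, hτ.1], hτu⟩
        have he : c + σ' * u + σ' * τ = c + σ' * (u + τ) := by ring
        rw [hfol τ hτ (by rw [he]; exact hm.1), he, hm.2]
      right
      intro u' hu'
      have hfu : u' - u ≤ f := by
        by_contra! hlt
        have := hforw f (right_mem_Icc.2 hfpos.le) (by linarith [hu'.2])
        rw [k1] at this
        exact hρ (u + f) ⟨by linarith [hu.1], by linarith [hu'.2]⟩ this.symm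
      have hτ : u' - u ∈ Icc 0 f := ⟨by linarith [hu'.1], hfu⟩
      have h1 := hforw _ hτ (by linarith [hu'.2])
      rw [add_sub_cancel] at h1
      rw [← h1]
      exact hkd _ hτ
  by_cases hback : ∃ u ∈ Ioo 0 η, dist ρ (g 0) = dist ρ (g u) - u
  · obtain ⟨u, hu, h⟩ := hback
    refine ⟨u, hu.1, hu.2.le.trans (hle.trans hle₀), Or.inl fun u' hu' => ?_⟩
    have hu'I : u' ∈ Icc 0 η := ⟨hu'.1, hu'.2.trans hu.2.le⟩
    have h1 := hg.abs_dist_sub_le ρ (hmem hu'I) (hmem (left_mem_Icc.2 hη.le))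
    have h2 := hg.abs_dist_sub_le ρ (hmem (Ioo_subset_Icc_self hu)) (hmem hu'I)
    rw [sub_zero, abs_of_nonneg hu'.1] at h1
    rw [abs_of_nonneg (sub_nonneg.2 hu'.2)] at h2
    linarith [(abs_le.1 h1).2, (abs_le.1 h2).2]
  · push Not at hback
    refine ⟨η / 2, half_pos hη, by linarith, Or.inr fun u' hu' => ?_⟩
    rcases hu'.1.eq_or_lt with rfl | hpos
    · rw [sub_zero]
    have hu'I : u' ∈ Ioo 0 η := ⟨hpos, by linarith [hu'.2]⟩
    refine eq_of_abs_sub_le_all fun δ hδ => ?_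
    set u := min (u' / 2) (δ / 2) with hu
    have hupos : 0 < u := lt_min (by linarith) (by linarith)
    have hu1 : u ≤ u' / 2 := min_le_left _ _
    have hu2 : u ≤ δ / 2 := min_le_right _ _
    have huI : u ∈ Ioo 0 η := ⟨hupos, by linarith [hu'I.2]⟩
    have h1 := (key u huI).resolve_left (hback u huI) u' ⟨by linarith, hu'I.2⟩
    have h2 := hg.abs_dist_sub_le ρ (hmem (Ioo_subset_Icc_self huI)) (hmem (left_mem_Icc.2 hη.le))
    rw [sub_zero, abs_of_pos hupos] at h2
    rw [h1, abs_le]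
    constructor <;> linarith [(abs_le.1 h2).1, (abs_le.1 h2).2]

/-- Along a segment without branch points, the distance from `ρ` first decreases and then
increases, with unit speed. -/
theorem exists_valley (G : MetricGraph Y) {ρ : Y} {γ : ℝ → Y} {t₀ t₁ : ℝ} (h01 : t₀ ≤ t₁)
    (hγ : IsometricOn γ (Icc t₀ t₁)) (hb : ∀ t ∈ Icc t₀ t₁, ¬ IsBranchPoint ρ (γ t)) :
    ∃ m ∈ Icc t₀ t₁, (∀ t ∈ Icc t₀ m, dist ρ (γ t) = dist ρ (γ t₀) - (t - t₀)) ∧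
      ∀ t ∈ Icc m t₁, dist ρ (γ t) = dist ρ (γ t₁) - (t₁ - t) := by
  have hcont : ContinuousOn (fun t => dist ρ (γ t)) (Icc t₀ t₁) :=
    (continuous_const.dist continuous_id).comp_continuousOn hγ.continuousOn
  have hgreat : ∀ (a : ℝ), a ∈ Icc t₀ t₁ → ∀ φ : ℝ → ℝ, Continuous φ → dist ρ (γ a) = φ a →
      ∃ m, IsGreatest {t ∈ Icc a t₁ | dist ρ (γ t) = φ t} m := by
    intro a ha φ hφ hφa
    have hcl : IsClosed {t ∈ Icc a t₁ | dist ρ (γ t) = φ t} := by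
      have := ((hcont.mono (Icc_subset_Icc ha.1 le_rfl)).sub hφ.continuousOn).preimage_isClosed_of_isClosed
        isClosed_Icc (isClosed_singleton (x := (0 : ℝ)))
      convert this using 1
      ext t
      simp [sub_eq_zero]
    exact (isCompact_Icc.of_isClosed_subset hcl fun t ht => ht.1).exists_isGreatest
      ⟨a, left_mem_Icc.2 ha.2, hφa⟩
  -- Here `m` ends the longest initial descent and `n` ends the longest ascent from `m`. If `n <
  -- t₁`, the slope after `n` is `1` or `-1`, and both lead to a contradiction.
  obtain ⟨m, hm, hmax⟩ := hgreat t₀ (left_mem_Icc.2 h01)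
    (fun t => dist ρ (γ t₀) - (t - t₀)) (by fun_prop) (by ring)
  have hm1 : dist ρ (γ m) = dist ρ (γ t₀) - (m - t₀) := hm.2
  obtain ⟨n, hn, hnmax⟩ := hgreat m hm.1
    (fun t => dist ρ (γ m) + (t - m)) (by fun_prop) (by ring)
  have hn1 : dist ρ (γ n) = dist ρ (γ m) + (n - m) := hn.2
  have hnI : n ∈ Icc t₀ t₁ := ⟨hm.1.1.trans hn.1.1, hn.1.2⟩
  have hn_eq : n = t₁ := by
    by_contra hne
    have hlt : n < t₁ := lt_of_le_of_ne hn.1.2 hne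
    have hiso := hγ.comp_add (t := n) hnI.1
    obtain ⟨η, hη, hle, hup | hdown⟩ := G.exists_slope (ρ := ρ) (sub_pos.2 hlt) hiso
    · have h1 := hup η (right_mem_Icc.2 hη.le)
      rw [add_zero] at h1
      have : n + η ≤ n := hnmax ⟨⟨by linarith [hn.1.1], by linarith⟩, by rw [h1, hn1]; ring⟩
      linarith
    · rw [add_zero] at hdown
      rcases hn.1.1.eq_or_lt with heq | hmn
      · have h1 := hdown η (right_mem_Icc.2 hη.le)
        rw [← heq, hm1] at h1
        have : m + η ≤ m := hmax ⟨⟨by linarith [hm.1.1], by linarith⟩, by rw [h1]; ring⟩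
        linarith
      -- The distance would turn from increasing to decreasing at `n`. Both directions of `γ` then
      -- descend from `n`, which makes it a branch point.
      · refine hb n hnI ⟨fun u => γ (n + u), fun u => γ (n - u), min η (n - m),
          lt_min hη (sub_pos.2 hmn), hiso.mono (Icc_subset_Icc le_rfl ((min_le_left _ _).trans hle)),
          (hγ.comp_sub hnI.2).mono
            (Icc_subset_Icc le_rfl ((min_le_right _ _).trans (by linarith [hm.1.1]))),
          by simp, by simp, fun u hu => hdown u ⟨hu.1, hu.2.trans (min_le_left _ _)⟩,
          fun u hu => ?_, ?_⟩
        · have hum : u ≤ n - m := hu.2.trans (min_le_right _ _)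
          have huI : n - u ∈ Icc t₀ t₁ := ⟨by linarith [hm.1.1], by linarith [hu.1]⟩
          have h1 := hγ.abs_dist_sub_le ρ huI hm.1
          have h2 := hγ.abs_dist_sub_le ρ hnI huI
          rw [abs_of_nonneg (a := n - u - m) (by linarith)] at h1
          rw [abs_of_nonneg (a := n - (n - u)) (by linarith [hu.1])] at h2
          simp only
          linarith [(abs_le.1 h1).2, (abs_le.1 h2).2]
        · rintro ⟨η', hη', heq⟩
          have hmin : 0 < min η' (min η (n - m)) := lt_min hη' (lt_min hη (sub_pos.2 hmn))
          have h1 : min η' (min η (n - m)) ≤ η := (min_le_right _ _).trans (min_le_left _ _)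
          have h2 : min η' (min η (n - m)) ≤ n - m := (min_le_right _ _).trans (min_le_right _ _)
          have := hγ.injOn ⟨by linarith [hnI.1], by linarith⟩ ⟨by linarith [hm.1.1], by linarith⟩
            (heq ⟨hmin.le, min_le_left _ _⟩)
          linarith
  subst hn_eq
  refine ⟨m, hm.1, fun t ht => ?_, fun t ht => ?_⟩
  · have htI : t ∈ Icc t₀ n := ⟨ht.1, ht.2.trans hm.1.2⟩
    have h1 := hγ.abs_dist_sub_le ρ (left_mem_Icc.2 h01) htI
    have h2 := hγ.abs_dist_sub_le ρ htI hm.1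
    rw [abs_sub_comm t₀, abs_of_nonneg (sub_nonneg.2 ht.1)] at h1
    rw [abs_sub_comm t, abs_of_nonneg (sub_nonneg.2 ht.2)] at h2
    linarith [(abs_le.1 h1).2, (abs_le.1 h2).2]
  · have htI : t ∈ Icc t₀ n := ⟨hm.1.1.trans ht.1, ht.2⟩
    have h1 := hγ.abs_dist_sub_le ρ htI hm.1
    have h2 := hγ.abs_dist_sub_le ρ hnI htI
    rw [abs_of_nonneg (sub_nonneg.2 ht.1)] at h1
    rw [abs_of_nonneg (sub_nonneg.2 ht.2)] at h2
    linarith [(abs_le.1 h1).2, (abs_le.1 h2).2]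

end MetricGraph

/-- Two segments running straight towards `ρ` from the same point agree as long as the first one
meets no branch point. -/
theorem eqOn_of_descending {Y : Type*} [MetricSpace Y] {ρ : Y} {g g' : ℝ → Y} {ℓ : ℝ}
    (hg : IsometricOn g (Icc 0 ℓ)) (hg' : IsometricOn g' (Icc 0 ℓ)) (h0 : g 0 = g' 0)
    (hd : ∀ u ∈ Icc 0 ℓ, dist ρ (g u) = dist ρ (g 0) - u)
    (hd' : ∀ u ∈ Icc 0 ℓ, dist ρ (g' u) = dist ρ (g' 0) - u)
    (hb : ∀ u ∈ Icc 0 ℓ, ¬ IsBranchPoint ρ (g u)) : EqOn g g' (Icc 0 ℓ) := by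
  -- The set of agreement is closed. If it could not be continued past `u`, the two germs at `u`
  -- would form a branch point.
  refine IsClosed.Icc_subset_of_forall_exists_gt (s := {u | g u = g' u}) ?_ h0 fun u hu y hy => ?_
  · have hc : ContinuousOn (fun u => dist (g u) (g' u)) (Icc 0 ℓ) :=
      continuous_dist.comp_continuousOn (hg.continuousOn.prodMk hg'.continuousOn)
    have := hc.preimage_isClosed_of_isClosed isClosed_Icc (isClosed_singleton (x := (0 : ℝ)))
    convert this using 1
    ext u
    simp [and_comm]
  · obtain ⟨heq, huI⟩ := hu
    have hu' : u ∈ Icc 0 ℓ := ⟨huI.1, huI.2.le⟩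
    have hnb := hb u hu'
    have hbase : g u = g' u := heq
    by_contra hemp
    refine hnb ⟨fun s => g (u + s), fun s => g' (u + s), ℓ - u, sub_pos.2 huI.2,
      hg.comp_add huI.1, hg'.comp_add huI.1, by simp, by simp [hbase], fun s hs => ?_,
      fun s hs => ?_, ?_⟩
    · simp only
      rw [hd _ ⟨by linarith [huI.1, hs.1], by linarith [hs.2]⟩, hd u hu']; ring
    · simp only
      rw [hd' _ ⟨by linarith [huI.1, hs.1], by linarith [hs.2]⟩, hbase, hd' u hu']; ring
    · rintro ⟨η, hη, h⟩
      have hmin : 0 < min η (y - u) := lt_min hη (sub_pos.2 hy)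
      exact hemp ⟨u + min η (y - u), h ⟨hmin.le, min_le_left _ _⟩, by linarith,
        by linarith [min_le_right η (y - u)]⟩

section Lift

variable {X T : Type*} [MetricSpace X] [GeodesicSpace X] [MetricSpace T] {π : X → T} {r : X}

/-- A segment of `T` that runs straight towards the root and meets no branch point has a lift from
every point over its start. -/
theorem exists_lift_of_descending (hlip : ∀ x y, dist (π x) (π y) ≤ dist x y)
    (hroot : ∀ x, dist (π r) (π x) = dist r x) {g : ℝ → T} {ℓ : ℝ} (hℓ : 0 ≤ ℓ)
    (hg : IsometricOn g (Icc 0 ℓ)) (hd : ∀ u ∈ Icc 0 ℓ, dist (π r) (g u) = dist (π r) (g 0) - u)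
    (hb : ∀ u ∈ Icc 0 ℓ, ¬ IsBranchPoint (π r) (g u)) {x : X} (hx : π x = g 0) :
    ∃ x', π x' = g ℓ ∧ dist x x' ≤ ℓ := by
  -- The lift lies on a segment `k` from `x` to `r`. Its projection loses distance to the root at
  -- unit speed and is 1-Lipschitz, hence is a descending segment and agrees with `g`.
  obtain ⟨k, k0, k1, hk⟩ := GeodesicSpace.exists_isometricOn x r
  have hle : ℓ ≤ dist x r := by
    have := hd ℓ (right_mem_Icc.2 hℓ)
    rw [← hx, hroot, dist_comm r] at this
    linarith [dist_nonneg (x := π r) (y := g ℓ)]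
  have hsub : ∀ {u}, u ∈ Icc 0 ℓ → u ∈ Icc 0 (dist x r) := fun hu => ⟨hu.1, hu.2.trans hle⟩
  have hkd : ∀ u ∈ Icc 0 ℓ, dist (π r) (π (k u)) = dist x r - u := by
    intro u hu
    have := hk _ (right_mem_Icc.2 dist_nonneg) u (hsub hu)
    rwa [k1, abs_of_nonneg (by linarith [(hsub hu).2]), ← hroot] at this
  have hiso : IsometricOn (fun u => π (k u)) (Icc 0 ℓ) := by
    intro u hu u' hu'
    refine le_antisymm ((hlip _ _).trans_eq (hk u (hsub hu) u' (hsub hu'))) ?_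
    have := abs_dist_sub_le (π (k u)) (π (k u')) (π r)
    rw [dist_comm _ (π r), dist_comm _ (π r), hkd u hu, hkd u' hu', abs_sub_comm] at this
    rwa [sub_sub_sub_cancel_left] at this
  have h0 : (fun u => π (k u)) 0 = π x := congrArg π k0
  have heq := eqOn_of_descending (ρ := π r) hg hiso (hx.symm.trans h0.symm) hd (fun u hu => by
    exact (hkd u hu).trans (by rw [k0, hroot, dist_comm r])) hb
  refine ⟨k ℓ, (heq (right_mem_Icc.2 hℓ)).symm, ?_⟩
  have := hk 0 (left_mem_Icc.2 dist_nonneg) ℓ (hsub (right_mem_Icc.2 hℓ))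
  rw [k0, zero_sub, abs_neg, abs_of_nonneg hℓ] at this
  exact this.le

/-- The distance between points over the ends of a segment of `T` without branch points. -/
theorem dist_le_of_no_branchPoint (𝒯 : MetricGraph T)
    (hlip : ∀ x y, dist (π x) (π y) ≤ dist x y) (hroot : ∀ x, dist (π r) (π x) = dist r x) {D : ℝ}
    (hfib : ∀ x y, π x = π y → dist x y ≤ D) {γ : ℝ → T} {t₀ t₁ : ℝ} (h01 : t₀ ≤ t₁)
    (hγ : IsometricOn γ (Icc t₀ t₁)) (hb : ∀ t ∈ Icc t₀ t₁, ¬ IsBranchPoint (π r) (γ t)) {x y : X}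
    (hx : π x = γ t₀) (hy : π y = γ t₁) : dist x y ≤ t₁ - t₀ + D := by
  -- Both ends lift down to points over the lowest point `γ m`, and these lie in one fibre.
  obtain ⟨m, hm, h1, h2⟩ := 𝒯.exists_valley (ρ := π r) h01 hγ hb
  obtain ⟨x', hx', hdx⟩ := exists_lift_of_descending hlip hroot (g := fun u => γ (t₀ + u))
    (sub_nonneg.2 hm.1) ((hγ.comp_add le_rfl).mono (Icc_subset_Icc le_rfl (by linarith [hm.2])))
    (fun u hu => by
      rw [h1 _ ⟨by linarith [hu.1], by linarith [hu.2]⟩, add_zero, add_sub_cancel_left])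
    (fun u hu => hb _ ⟨by linarith [hu.1], by linarith [hu.2, hm.2]⟩) (hx.trans (by simp))
  obtain ⟨y', hy', hdy⟩ := exists_lift_of_descending hlip hroot (g := fun u => γ (t₁ - u))
    (sub_nonneg.2 hm.2) ((hγ.comp_sub le_rfl).mono (Icc_subset_Icc le_rfl (by linarith [hm.1])))
    (fun u hu => by
      rw [h2 _ ⟨by linarith [hu.2], by linarith [hu.1]⟩, sub_zero, sub_sub_cancel])
    (fun u hu => hb _ ⟨by linarith [hu.2, hm.1], by linarith [hu.1]⟩) (hy.trans (by simp))
  have hD := hfib x' y' (by rw [hx', hy']; congr 1; ring)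
  have h4 := dist_triangle4 x x' y' y
  rw [dist_comm y' y] at h4
  linarith

/-- Split at a branch time `τ` and jump from just before to just after it at cost `D`. Induction on
both sides gives `(2k + 1) + 1 + (2k' + 1) = 2(k + k' + 1) + 1` multiples of `D`, where `k + k'` is
less than the number of branch times. -/
theorem dist_le_of_card_branchPoint (𝒯 : MetricGraph T) (hsurj : Function.Surjective π)
    (hlip : ∀ x y, dist (π x) (π y) ≤ dist x y) (hroot : ∀ x, dist (π r) (π x) = dist r x)
    {D η : ℝ} (hη : 0 < η) (hfib : ∀ x y, dist (π x) (π y) ≤ η → dist x y ≤ D) {γ : ℝ → T}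
    {F : Finset ℝ} {t₀ t₁ : ℝ} (h01 : t₀ ≤ t₁) (hγ : IsometricOn γ (Icc t₀ t₁))
    (hb : ∀ t ∈ Icc t₀ t₁, IsBranchPoint (π r) (γ t) → t ∈ F) {x y : X}
    (hx : π x = γ t₀) (hy : π y = γ t₁) : dist x y ≤ t₁ - t₀ + (2 * F.card + 1) * D := by
  have hD : 0 ≤ D := by
    have := hfib r r (by rw [dist_self]; exact hη.le)
    rwa [dist_self] at this
  induction hk : F.card using Nat.strong_induction_on generalizing F t₀ t₁ x y with
  | _ k ih =>
  subst hk
  have hF : (0 : ℝ) ≤ F.card := Nat.cast_nonneg _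
  by_cases hnb : ∀ t ∈ Icc t₀ t₁, ¬ IsBranchPoint (π r) (γ t)
  · have := dist_le_of_no_branchPoint 𝒯 hlip hroot (D := D)
      (fun x y h => hfib x y (by rw [h, dist_self]; exact hη.le)) h01 hγ hnb hx hy
    nlinarith [mul_nonneg hF hD]
  push Not at hnb
  obtain ⟨τ, hτ, hbτ⟩ := hnb
  have hτF := hb τ hτ hbτ
  have hcard : (F.filter (· < τ)).card + (F.filter (τ < ·)).card + 1 ≤ F.card := by
    rw [← Finset.card_union_of_disjoint, ← Finset.card_singleton τ,
      ← Finset.card_union_of_disjoint]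
    · refine Finset.card_le_card fun t ht => ?_
      simp only [Finset.mem_union, Finset.mem_filter, Finset.mem_singleton] at ht
      rcases ht with (ht | ht) | rfl
      · exact ht.1
      · exact ht.1
      · exact hτF
    · rw [Finset.disjoint_singleton_right]
      simp
    · rw [Finset.disjoint_filter]
      exact fun t _ h h' => lt_asymm h h'
  have hcard' : ((F.filter (· < τ)).card : ℝ) + (F.filter (τ < ·)).card + 1 ≤ F.card := by
    exact_mod_cast hcard
  -- The left piece stops before `τ`, so that `τ` no longer counts in it. Gaps of `η / 2` on both
  -- sides keep the jump within `η`. If `τ = t₀`, the piece is the point `x`.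
  obtain ⟨s, hs, z, hz, hdz⟩ : ∃ s ∈ Icc (τ - η / 2) τ, ∃ z, π z = γ s ∧
      t₀ ≤ s ∧ dist x z ≤ s - t₀ + (2 * (F.filter (· < τ)).card + 1) * D := by
    rcases hτ.1.eq_or_lt with rfl | hlt
    · refine ⟨t₀, ⟨by linarith, le_rfl⟩, x, hx, le_rfl, ?_⟩
      rw [dist_self, sub_self, zero_add]; exact mul_nonneg (by positivity) hD
    · have hs : max t₀ (τ - η / 2) < τ := max_lt hlt (by linarith)
      obtain ⟨z, hz⟩ := hsurj (γ (max t₀ (τ - η / 2)))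
      refine ⟨_, ⟨le_max_right _ _, hs.le⟩, z, hz, le_max_left _ _, ?_⟩
      refine ih _ (by omega) (le_max_left _ _)
        (hγ.mono (Icc_subset_Icc le_rfl (hs.le.trans hτ.2))) (fun t ht hbt => ?_) hx hz rfl
      exact Finset.mem_filter.2 ⟨hb t ⟨ht.1, ht.2.trans (hs.le.trans hτ.2)⟩ hbt, ht.2.trans_lt hs⟩
  obtain ⟨s', hs', z', hz', hdz'⟩ : ∃ s' ∈ Icc τ (τ + η / 2), ∃ z', π z' = γ s' ∧
      s' ≤ t₁ ∧ dist z' y ≤ t₁ - s' + (2 * (F.filter (τ < ·)).card + 1) * D := by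
    rcases hτ.2.eq_or_lt with rfl | hlt
    · refine ⟨τ, ⟨le_rfl, by linarith⟩, y, hy, le_rfl, ?_⟩
      rw [dist_self, sub_self, zero_add]; exact mul_nonneg (by positivity) hD
    · have hs : τ < min t₁ (τ + η / 2) := lt_min hlt (by linarith)
      obtain ⟨z, hz⟩ := hsurj (γ (min t₁ (τ + η / 2)))
      refine ⟨_, ⟨hs.le, min_le_right _ _⟩, z, hz, min_le_left _ _, ?_⟩
      refine ih _ (by omega) (min_le_left _ _)
        (hγ.mono (Icc_subset_Icc (hτ.1.trans hs.le) le_rfl)) (fun t ht hbt => ?_) hz hy rfl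
      exact Finset.mem_filter.2 ⟨hb t ⟨(hτ.1.trans hs.le).trans ht.1, ht.2⟩ hbt, hs.trans_le ht.1⟩
  have hjump : dist z z' ≤ D := hfib z z' (by
    rw [hz, hz', hγ s ⟨hdz.1, hs.2.trans hτ.2⟩ s' ⟨hτ.1.trans hs'.1, hdz'.1⟩, abs_le]
    constructor <;> linarith [hs.1, hs.2, hs'.1, hs'.2])
  have h4 := dist_triangle4 x z z' y
  nlinarith [hdz.2, hdz'.2, hs.2, hs'.1, mul_le_mul_of_nonneg_right hcard' hD]

/-- The distortion of a projection to a metric graph that preserves the distance to the root is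
bounded by the first Betti number and the diameter of the fibres. -/
theorem dist_le_dist_add_betti1 (𝒯 : MetricGraph T) (hsurj : Function.Surjective π)
    (hlip : ∀ x y, dist (π x) (π y) ≤ dist x y) (hroot : ∀ x, dist (π r) (π x) = dist r x)
    {D η : ℝ} (hη : 0 < η) (hfib : ∀ x y, dist (π x) (π y) ≤ η → dist x y ≤ D) (x y : X) :
    dist x y ≤ dist (π x) (π y) + (2 * 𝒯.betti1 + 1) * D := by
  classical
  have hD : 0 ≤ D := by
    have := hfib r r (by rw [dist_self]; exact hη.le)
    rwa [dist_self] at this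
  have := 𝒯.geodesic
  obtain ⟨γ, h0, h1, hγ⟩ := GeodesicSpace.exists_isometricOn (π x) (π y)
  set B : Set ℝ := {t ∈ Icc 0 (dist (π x) (π y)) | IsBranchPoint (π r) (γ t)} with hB
  have hcard : ∀ F : Finset ℝ, ↑F ⊆ B → F.card ≤ 𝒯.betti1 := by
    intro F hF
    rw [← Finset.card_image_of_injOn (f := γ) (hγ.injOn.mono fun t ht => (hF ht).1)]
    refine 𝒯.card_branchPoints_le (π r) _ fun z hz => ?_
    obtain ⟨t, ht, rfl⟩ := Finset.mem_image.1 hz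
    exact (hF ht).2
  have hfin : B.Finite := by
    by_contra hinf
    obtain ⟨F, hF, hFc⟩ := Set.Infinite.exists_subset_card_eq hinf (𝒯.betti1 + 1)
    have := hcard F hF
    omega
  have hle : (hfin.toFinset.card : ℝ) ≤ 𝒯.betti1 := by
    exact_mod_cast hcard _ (by rw [hfin.coe_toFinset])
  have := dist_le_of_card_branchPoint 𝒯 hsurj hlip hroot hη hfib (F := hfin.toFinset) dist_nonneg
    hγ (fun t ht hb => hfin.mem_toFinset.2 ⟨ht, hb⟩) h0.symm h1.symm
  nlinarith [mul_le_mul_of_nonneg_right hle hD]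

end Lift

/-! ### Path components of annuli, Reeb graphs and correspondences -/

/-- A segment is described by its distance equality, which is the form that the triangle inequality
needs later. -/
theorem GeodesicSpace.joinedIn_segment {X : Type*} [MetricSpace X] [GeodesicSpace X] (x y : X) :
    JoinedIn {z | dist x z + dist z y ≤ dist x y} x y := by
  obtain ⟨g, h0, h1, hg⟩ := GeodesicSpace.exists_isometricOn x y
  have hp : IsPathConnected (g '' Icc 0 (dist x y)) :=
    ((convex_Icc 0 (dist x y)).isPathConnected (nonempty_Icc.2 dist_nonneg)).image' hg.continuousOn
  refine (hp.joinedIn x ⟨0, left_mem_Icc.2 dist_nonneg, h0⟩ y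
    ⟨_, right_mem_Icc.2 dist_nonneg, h1⟩).mono ?_
  rintro _ ⟨t, ht, rfl⟩
  have e1 := hg 0 (left_mem_Icc.2 dist_nonneg) t ht
  have e2 := hg t ht _ (right_mem_Icc.2 dist_nonneg)
  rw [h0, abs_sub_comm, sub_zero, abs_of_nonneg ht.1] at e1
  rw [h1, abs_sub_comm, abs_of_nonneg (sub_nonneg.2 ht.2)] at e2
  change dist x (g t) + dist (g t) y ≤ dist x y
  rw [e1, e2]
  linarith

/-! ### Paths of the Reeb quotient and paths of `X` -/

section Reeb

variable {X : Type*} [MetricSpace X] {ι : Type*} {r : X} {a b : ι → ℝ} {α η t : ℝ}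

/-- All points of a generating chain have the same level, and each link stays in an interval of
length at most `α` containing this level. -/
theorem joinedIn_of_eqvGen (hα : 0 ≤ α) (hlen : ∀ i, b i - a i ≤ α) {x y : X}
    (h : Relation.EqvGen (reebRel r a b) x y) (hx : dist r x ∈ Ioo (t - η) (t + η)) :
    JoinedIn {z | dist r z ∈ Ioo (t - α - η) (t + α + η)} x y := by
  induction h with
  | rel x y h =>
    obtain ⟨_, i, hi⟩ := h
    refine hi.mono fun z hz => ?_
    have h1 : dist r x ∈ Ioo (a i) (b i) := hi.source_mem
    have h2 : dist r z ∈ Ioo (a i) (b i) := hz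
    have := hlen i
    exact ⟨by linarith [h1.2, h2.1, hx.1], by linarith [h1.1, h2.2, hx.2]⟩
  | refl x => exact JoinedIn.refl ⟨by linarith [hx.1], by linarith [hx.2]⟩
  | symm x y h ih => exact (ih (dist_eq_of_eqvGen r a b _ _ h ▸ hx)).symm
  | trans x y z h _ ih1 ih2 => exact (ih1 hx).trans (ih2 (dist_eq_of_eqvGen r a b _ _ h ▸ hx))

theorem ReebQuotient.eqvGen_of_mk_eq {x y : X}
    (h : ReebQuotient.mk r a b x = ReebQuotient.mk r a b y) :
    Relation.EqvGen (reebRel r a b) x y :=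
  Quotient.exact (s := reebSetoid r a b) h

theorem edist_height_le_eVariationOn {p q : ReebQuotient r a b} (c : Path p q) (s s' : unitInterval) :
    edist (ReebQuotient.height r a b (c s)) (ReebQuotient.height r a b (c s')) ≤
      eVariationOn (fun t => ReebQuotient.height r a b (c t)) univ :=
  eVariationOn.edist_le (fun t => ReebQuotient.height r a b (c t)) (mem_univ s) (mem_univ s')

variable [GeodesicSpace X]

/-- Points over the ends of a path of the quotient space that stays near the level `t` are joined
by a path of `X` near this level. -/
theorem joinedIn_of_path (hα : 0 ≤ α) (hlen : ∀ i, b i - a i ≤ α) {x y : X}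
    (c : Path (ReebQuotient.mk r a b x) (ReebQuotient.mk r a b y))
    (hc : ∀ s, ReebQuotient.height r a b (c s) ∈ Ioo (t - η) (t + η)) :
    JoinedIn {z | dist r z ∈ Ioo (t - α - η) (t + α + η)} x y := by
  set W : Set X := {z | dist r z ∈ Ioo (t - α - η) (t + α + η)} with hW
  have hsub : ∀ {z}, dist r z ∈ Ioo (t - η) (t + η) → z ∈ W := fun hz =>
    ⟨by linarith [hz.1], by linarith [hz.2]⟩
  have hlevel : ∀ {s z}, ReebQuotient.mk r a b z = c s → dist r z ∈ Ioo (t - η) (t + η) := by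
    intro s z hz
    have := hc s
    rw [← hz] at this
    exact this
  have hq : IsQuotientMap (ReebQuotient.mk r a b) := isQuotientMap_quotient_mk'
  have key : ∀ s s' : unitInterval, ∀ z z', ReebQuotient.mk r a b z = c s →
      ReebQuotient.mk r a b z' = c s' → JoinedIn W z z' := by
    intro s s'
    refine isPreconnected_univ.induction₂ (fun s s' => ∀ z z', ReebQuotient.mk r a b z = c s →
      ReebQuotient.mk r a b z' = c s' → JoinedIn W z z') ?_ ?_ ?_ (mem_univ s) (mem_univ s')
    · intro s _
      obtain ⟨z₀, hz₀⟩ := ReebQuotient.mk_surjective r a b (c s)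
      -- The points near level `t` that `z₀` reaches inside `W` form a saturated set, by
      -- `joinedIn_of_eqvGen`, and an open one, because short segments stay near the level. Its
      -- image `O` is therefore open and contains `c s'` for all `s'` close to `s`.
      set O : Set (ReebQuotient r a b) := ReebQuotient.mk r a b ''
        {z | dist r z ∈ Ioo (t - η) (t + η) ∧ JoinedIn W z₀ z} with hO
      have hpre : ReebQuotient.mk r a b ⁻¹' O =
          {z | dist r z ∈ Ioo (t - η) (t + η) ∧ JoinedIn W z₀ z} := by
        refine Subset.antisymm ?_ (subset_preimage_image _ _)
        rintro z ⟨z', ⟨h1, h2⟩, h3⟩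
        have h4 := ReebQuotient.eqvGen_of_mk_eq h3
        exact ⟨dist_eq_of_eqvGen r a b _ _ h4 ▸ h1, h2.trans (joinedIn_of_eqvGen hα hlen h4 h1)⟩
      have hopen : IsOpen O := by
        rw [← hq.isOpen_preimage, hpre, Metric.isOpen_iff]
        rintro z ⟨h1, h2⟩
        obtain ⟨κ, hκ, hball⟩ := Metric.isOpen_iff.1
          (isOpen_Ioo.preimage (continuous_const.dist continuous_id : Continuous fun z => dist r z))
          z h1
        refine ⟨κ, hκ, fun z' hz' => ⟨hball hz', h2.trans ?_⟩⟩
        refine (GeodesicSpace.joinedIn_segment z z').mono fun w hw => hsub (hball ?_)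
        rw [Metric.mem_ball, dist_comm] at hz' ⊢
        have hw' : dist z w + dist w z' ≤ dist z z' := hw
        linarith [dist_nonneg (x := w) (y := z')]
      have hmem : c s ∈ O := ⟨z₀, ⟨hlevel hz₀, JoinedIn.refl (hsub (hlevel hz₀))⟩, hz₀⟩
      rw [nhdsWithin_univ]
      filter_upwards [c.continuous.continuousAt.preimage_mem_nhds (hopen.mem_nhds hmem)]
        with s' hs' z z' hz hz'
      have h1 : z' ∈ ReebQuotient.mk r a b ⁻¹' O := by
        rw [mem_preimage, hz']; exact hs'
      rw [hpre] at h1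
      exact (joinedIn_of_eqvGen hα hlen (ReebQuotient.eqvGen_of_mk_eq (hz.trans hz₀.symm))
        (hlevel hz)).trans h1.2
    · intro s s' s'' _ _ _ h1 h2 z z'' hz hz''
      obtain ⟨z', hz'⟩ := ReebQuotient.mk_surjective r a b (c s')
      exact (h1 z z' hz hz').trans (h2 z' z'' hz' hz'')
    · intro s s' _ _ h z z' hz hz'
      exact (h z' z hz' hz).symm
  exact key 0 1 x y c.source.symm c.target.symm

/-- Some path of the quotient has variation of `d_*` less than `η`, so its heights stay within `η`
of the initial one. -/
theorem joinedIn_of_dist_proj_lt (hα : 0 ≤ α) (hlen : ∀ i, b i - a i ≤ α) {x y : X}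
    (h : dist (ReebGraph.proj r a b x) (ReebGraph.proj r a b y) < η) :
    JoinedIn {z | dist r z ∈ Ioo (dist r x - α - η) (dist r x + α + η)} x y := by
  rw [ReebGraph.dist_proj, ← ENNReal.lt_ofReal_iff_toReal_lt (reebEDist_ne_top r a b _ _),
    reebEDist, iInf_lt_iff] at h
  obtain ⟨c, hc⟩ := h
  refine joinedIn_of_path hα hlen c fun s => ?_
  have h1 := (edist_height_le_eVariationOn c s 0).trans_lt hc
  rw [c.source, edist_lt_ofReal, Real.dist_eq, abs_lt] at h1
  change -η < _ - dist r x ∧ _ - dist r x < η at h1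
  exact ⟨by linarith [h1.1], by linarith [h1.2]⟩

theorem ReebGraph.dist_proj_le (x y : X) :
    dist (ReebGraph.proj r a b x) (ReebGraph.proj r a b y) ≤ dist x y := by
  rw [ReebGraph.dist_proj]
  exact ENNReal.toReal_le_of_le_ofReal dist_nonneg (reebEDist_mk_le r a b x y)

/-- The variation of `d_*` along a path is at least the height difference of its ends, which here is
`dist r x`. -/
theorem ReebGraph.dist_proj_root (x : X) :
    dist (ReebGraph.proj r a b r) (ReebGraph.proj r a b x) = dist r x := by
  refine le_antisymm (ReebGraph.dist_proj_le r x) ?_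
  rw [ReebGraph.dist_proj, ← ENNReal.ofReal_le_iff_le_toReal (reebEDist_ne_top r a b _ _)]
  refine le_iInf fun c => le_trans (le_of_eq ?_) (edist_height_le_eVariationOn c 1 0)
  rw [c.source, c.target, edist_dist, Real.dist_eq]
  change _ = ENNReal.ofReal |dist r x - dist r r|
  rw [dist_self, sub_zero, abs_of_nonneg dist_nonneg]

end Reeb

/-! ### From local to global approximation -/

section Correspondence

variable {X Y : Type*} [MetricSpace X] [MetricSpace Y] {C : Set (X × Y)} {ε R δ : ℝ}

/-- A correspondence that nearly preserves the small distances of a geodesic space increases its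
large distances by a controlled amount. -/
theorem dist_le_of_local_approx [GeodesicSpace Y] (hC : ∀ y, ∃ x, (x, y) ∈ C) (hR : 0 < R)
    (hε : 0 ≤ ε)
    (happ : ∀ p ∈ C, ∀ q ∈ C, dist p.2 q.2 ≤ R → dist p.1 q.1 ≤ dist p.2 q.2 + 2 * ε)
    {p q : X × Y} (hp : p ∈ C) (hq : q ∈ C) :
    dist p.1 q.1 ≤ dist p.2 q.2 + 2 * ε * (dist p.2 q.2 / R + 1) := by
  obtain ⟨g, h0, h1, hg⟩ := GeodesicSpace.exists_isometricOn p.2 q.2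
  set L := dist p.2 q.2 with hL
  have hLR : 0 ≤ L / R := div_nonneg dist_nonneg hR.le
  -- Cut the segment into `n` steps of length at most `R`, each of which costs `2 * ε`. The `+ 1`
  -- keeps `n` positive when `L < R`.
  set n : ℕ := ⌊L / R⌋₊ + 1 with hn
  have hn0 : (0 : ℝ) < n := by positivity
  have hn1 : L / R < n := by rw [hn]; push_cast; exact Nat.lt_floor_add_one _
  have hn2 : (n : ℝ) ≤ L / R + 1 := by rw [hn]; push_cast; linarith [Nat.floor_le hLR]
  have hstep : L / n ≤ R := by
    rw [div_le_iff₀ hn0]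
    rw [div_lt_iff₀ hR] at hn1
    linarith
  have hmem : ∀ i : ℕ, i ≤ n → i * (L / n) ∈ Icc 0 L := by
    intro i hi
    refine ⟨by positivity, ?_⟩
    have : (i : ℝ) ≤ n := by exact_mod_cast hi
    calc i * (L / n) ≤ n * (L / n) := mul_le_mul_of_nonneg_right this (by positivity)
      _ = L := by field_simp
  have hd : ∀ i : ℕ, i + 1 ≤ n → dist (g (i * (L / n))) (g ((i + 1 : ℕ) * (L / n))) = L / n := by
    intro i hi
    rw [hg _ (hmem i (by omega)) _ (hmem _ hi), abs_sub_comm, ← sub_mul]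
    push_cast
    rw [add_sub_cancel_left, one_mul, abs_of_nonneg (by positivity)]
  have key : ∀ i : ℕ, i + 1 ≤ n → ∀ x, (x, g ((i + 1 : ℕ) * (L / n))) ∈ C →
      dist p.1 x ≤ (i + 1 : ℕ) * (L / n + 2 * ε) := by
    intro i
    induction i with
    | zero =>
      intro hi x hx
      have h2 := hd 0 hi
      rw [Nat.cast_zero, zero_mul, h0] at h2
      have h3 := happ p hp _ hx (h2.le.trans hstep)
      simp only [h2] at h3
      simpa using h3
    | succ i ih =>
      intro hi x hx
      obtain ⟨x', hx'⟩ := hC (g ((i + 1 : ℕ) * (L / n)))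
      have h2 := hd (i + 1) hi
      have h3 := happ _ hx' _ hx (h2.le.trans hstep)
      simp only [h2] at h3
      have h4 := ih (by omega) x' hx'
      have h5 := dist_triangle p.1 x' x
      push_cast at h4 ⊢
      linarith
  have hlast : ((⌊L / R⌋₊ + 1 : ℕ) : ℝ) * (L / n) = L := by rw [← hn]; field_simp
  have h2 := key ⌊L / R⌋₊ le_rfl q.1 (by rw [hlast, h1]; exact hq)
  rw [mul_add, hlast] at h2
  refine h2.trans ?_
  rw [← hn]
  nlinarith

theorem abs_dist_sub_dist_le_of_local_approx [GeodesicSpace X] [GeodesicSpace Y] [CompactSpace Y]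
    (hC : IsCorrespondence C) (hR : 0 < R) (hε : 0 ≤ ε)
    (happ : ∀ p ∈ C, ∀ q ∈ C, min (dist p.1 q.1) (dist p.2 q.2) ≤ R →
      |dist p.1 q.1 - dist p.2 q.2| ≤ 2 * ε) {p q : X × Y} (hp : p ∈ C) (hq : q ∈ C) :
    |dist p.1 q.1 - dist p.2 q.2| ≤ 2 * (ε * (Metric.diam (univ : Set Y) / R + 1)) := by
  set M := Metric.diam (univ : Set Y) with hM
  have hdM : dist p.2 q.2 ≤ M :=
    Metric.dist_le_diam_of_mem isCompact_univ.isBounded (mem_univ _) (mem_univ _)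
  have hmono : ∀ {L}, L ≤ M → 2 * ε * (L / R + 1) ≤ 2 * (ε * (M / R + 1)) := by
    intro L hL
    rw [mul_assoc]
    have : L / R ≤ M / R := div_le_div_of_nonneg_right hL hR.le
    gcongr
  have h1 := dist_le_of_local_approx hC.2 hR hε (fun p hp q hq h => by
    have := (abs_le.1 (happ p hp q hq ((min_le_right _ _).trans h))).2
    linarith) hp hq
  have h2 := dist_le_of_local_approx (C := Prod.swap ⁻¹' C) (p := p.swap) (q := q.swap) hC.1 hR hε
    (fun p hp q hq h => by
      have := (abs_le.1 (happ _ hp _ hq ((min_le_left _ _).trans h))).1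
      simp only [Prod.fst_swap, Prod.snd_swap] at this
      linarith) hp hq
  simp only [Prod.fst_swap, Prod.snd_swap] at h2
  rw [abs_le]
  constructor
  -- The reverse bound involves the distance in `X`. It matters only when this is at most the
  -- distance in `Y`, hence at most `M`, so the diameter of `X` is not needed.
  · rcases le_total (dist p.1 q.1) (dist p.2 q.2) with h | h
    · linarith [hmono (h.trans hdM)]
    · have : 0 ≤ 2 * (ε * (M / R + 1)) := by
        have : 0 ≤ M := Metric.diam_nonneg
        positivity
      linarith
  · linarith [hmono hdM]

/-- A path in an annulus of `X` gives a path in a slightly larger annulus of a geodesic space. -/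
theorem joinedIn_annulus_of_approx [GeodesicSpace Y] (hC : ∀ x, ∃ y, (x, y) ∈ C)
    (happ : ∀ p ∈ C, ∀ q ∈ C, |dist p.1 q.1 - dist p.2 q.2| ≤ 2 * δ) {r : X} {ρ : Y}
    (hr : (r, ρ) ∈ C) {κ : ℝ} (hκ : 0 < κ) {lo hi : ℝ} {x x' : X} {y y' : Y}
    (hx : JoinedIn {z | dist r z ∈ Ioo lo hi} x x') (hy : (x, y) ∈ C) (hy' : (x', y') ∈ C) :
    JoinedIn {z | dist ρ z ∈ Icc (lo - 3 * δ - κ) (hi + 3 * δ + κ)} y y' := by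
  set S : Set Y := {z | dist ρ z ∈ Icc (lo - 3 * δ - κ) (hi + 3 * δ + κ)} with hS
  obtain ⟨γ, hγ⟩ := hx
  -- The ends `y`, `y'` leave the annulus by at most `2δ`. A point of the segment between them is no
  -- farther from the nearer end than half its length, which is at most `κ + δ`. Together this is
  -- the margin `3δ + κ`.
  have hlocal : ∀ s s' : unitInterval, dist (γ s) (γ s') < 2 * κ → ∀ y y', (γ s, y) ∈ C →
      (γ s', y') ∈ C → JoinedIn S y y' := by
    intro s s' hss y y' hy hy'
    refine (GeodesicSpace.joinedIn_segment y y').mono fun w hw => ?_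
    have hw' : dist y w + dist w y' ≤ dist y y' := hw
    have h1 := abs_le.1 (happ _ hy _ hy')
    have h2 := abs_le.1 (happ _ hr _ hy)
    have h3 := abs_le.1 (happ _ hr _ hy')
    have h4 : dist r (γ s) ∈ Ioo lo hi := hγ s
    have h5 : dist r (γ s') ∈ Ioo lo hi := hγ s'
    simp only at h1 h2 h3
    have t1 := dist_triangle ρ y w
    have t2 := dist_triangle ρ y' w
    have t3 := dist_triangle ρ w y
    have t4 := dist_triangle ρ w y'
    rw [dist_comm y' w] at t2
    rw [dist_comm w y] at t3
    exact ⟨by linarith [h4.1, h5.1], by linarith [h4.2, h5.2]⟩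
  have key : ∀ s s' : unitInterval, ∀ y y', (γ s, y) ∈ C → (γ s', y') ∈ C → JoinedIn S y y' := by
    intro s s'
    refine isPreconnected_univ.induction₂ (fun s s' => ∀ y y', (γ s, y) ∈ C → (γ s', y') ∈ C →
      JoinedIn S y y') ?_ ?_ ?_ (mem_univ s) (mem_univ s')
    · intro s _
      rw [nhdsWithin_univ]
      filter_upwards [γ.continuous.continuousAt.preimage_mem_nhds
        (Metric.ball_mem_nhds (γ s) (by linarith : 0 < 2 * κ))] with s' hs'
      rw [mem_preimage, Metric.mem_ball, dist_comm] at hs'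
      exact hlocal s s' hs'
    · intro s s' s'' _ _ _ h1 h2 z z'' hz hz''
      obtain ⟨z', hz'⟩ := hC (γ s')
      exact (h1 z z' hz hz').trans (h2 z' z'' hz' hz'')
    · intro s s' _ _ h z z' hz hz'
      exact (h z' z hz' hz).symm
  exact key 0 1 y y' (by rwa [γ.source]) (by rwa [γ.target])

end Correspondence

/-! ### Dependence of the edge count on the length -/

namespace MetricGraph

variable {Y : Type*} [MetricSpace Y] (G : MetricGraph Y)

theorem edgeCount_mono {ℓ ℓ' : ℝ} (h : ℓ ≤ ℓ') : G.edgeCount ℓ ≤ G.edgeCount ℓ' :=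
  Nat.card_le_card_of_injective (fun e : {e : G.E // G.len e ≤ ℓ} =>
    (⟨e.1, e.2.trans h⟩ : {e : G.E // G.len e ≤ ℓ'})) fun _ _ he =>
      Subtype.ext (congrArg (fun x : {e : G.E // G.len e ≤ ℓ'} => x.1) he)

/-- The count is a step function that jumps only on reaching an edge length from below, so just to
the right of `ℓ` it is constant. -/
theorem eventually_edgeCount_eq (ℓ : ℝ) : ∀ᶠ ℓ' in 𝓝[≥] ℓ, G.edgeCount ℓ' = G.edgeCount ℓ := by
  have h : ∀ᶠ ℓ' in 𝓝[≥] ℓ, ∀ e, G.len e ≤ ℓ' ↔ G.len e ≤ ℓ := by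
    refine eventually_all.2 fun e => ?_
    by_cases he : G.len e ≤ ℓ
    · filter_upwards [self_mem_nhdsWithin] with ℓ' hℓ'
      exact iff_of_true (he.trans hℓ') he
    · filter_upwards [mem_nhdsWithin_of_mem_nhds (Iio_mem_nhds (not_le.1 he))] with ℓ' hℓ'
      exact iff_of_false (not_le.2 hℓ') he
  filter_upwards [h] with ℓ' hℓ'
  simp only [edgeCount, hℓ']

end MetricGraph

/-! ### The reconstruction theorem -/

section Reconstruction

variable {G : Type*} [MetricSpace G] [CompactSpace G]
  {X : Type*} [MetricSpace X] [GeodesicSpace X] {ε R α : ℝ} {r : X} {ι : Type*} {a b : ι → ℝ}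

/-- Points of `X` that are close in the `α`-Reeb graph are at bounded distance. -/
theorem dist_le_of_dist_proj_le (𝒢 : MetricGraph G) (hε : 0 < ε) (hR : 0 < R) (hα : 0 < α)
    (hlen : ∀ i, b i - a i ≤ α) (happ : IsLocalApprox ε R X G) {δ : ℝ}
    (hδ : δ = ε * (Metric.diam (univ : Set G) / R + 1)) {x y : X}
    (hxy : dist (ReebGraph.proj r a b x) (ReebGraph.proj r a b y) ≤ δ / 8) :
    dist x y ≤ 4 * (2 + 𝒢.edgeCount (4 * (α + 4 * δ))) * (α + 4 * δ) := by
  have := 𝒢.geodesic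
  have hδ0 : 0 < δ := by
    rw [hδ]
    have : 0 ≤ Metric.diam (univ : Set G) := Metric.diam_nonneg
    positivity
  obtain ⟨C, hC, hCapp⟩ := happ
  have hdist : ∀ p ∈ C, ∀ q ∈ C, |dist p.1 q.1 - dist p.2 q.2| ≤ 2 * δ := fun p hp q hq =>
    hδ ▸ abs_dist_sub_dist_le_of_local_approx hC hR hε.le hCapp hp hq
  obtain ⟨ρ, hρ⟩ := hC.1 r
  obtain ⟨p, hp⟩ := hC.1 x
  obtain ⟨q, hq⟩ := hC.1 y
  -- With `η = κ = δ / 4` the annulus in `G` has width `2 (α + δ / 4 + 3δ + δ / 4) = 2α + 7δ`. The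
  -- gap up to `2α + 8δ` absorbs the final error `2δ` of passing from `dist p q` back to `dist x y`.
  have h1 := joinedIn_of_dist_proj_lt (η := δ / 4) hα.le hlen (hxy.trans_lt (by linarith))
  have h2 := joinedIn_annulus_of_approx hC.1 hdist hρ (κ := δ / 4) (by linarith) h1 hp hq
  have h3 : JoinedIn {z | dist ρ z ∈ Icc (dist r x - α - δ / 4 - 3 * δ - δ / 4)
      (dist r x - α - δ / 4 - 3 * δ - δ / 4 + (2 * α + 7 * δ))} p q := by
    convert h2 using 5
    ring
  have h4 := 𝒢.dist_le_of_joinedIn_annulus (by linarith) h3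
  have h5 : (𝒢.edgeCount (2 * (2 * α + 7 * δ)) : ℝ) ≤ 𝒢.edgeCount (4 * (α + 4 * δ)) := by
    exact_mod_cast 𝒢.edgeCount_mono (by linarith)
  have h6 := (abs_le.1 (hdist _ hp _ hq)).2
  have h7 : (0 : ℝ) ≤ 𝒢.edgeCount (4 * (α + 4 * δ)) := Nat.cast_nonneg _
  have h8 : 2 * (2 * α + 7 * δ) * (2 + 𝒢.edgeCount (2 * (2 * α + 7 * δ))) ≤
      2 * (2 * α + 7 * δ) * (2 + 𝒢.edgeCount (4 * (α + 4 * δ))) :=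
    mul_le_mul_of_nonneg_left (by linarith) (by linarith)
  simp only at h6
  nlinarith [mul_nonneg hδ0.le h7]

theorem ghDist_reebGraph_le [CompactSpace X] [Nonempty X] (𝒯 : MetricGraph (ReebGraph r a b))
    {D η : ℝ} (hη : 0 < η) (hfib : ∀ x y : X,
      dist (ReebGraph.proj r a b x) (ReebGraph.proj r a b y) ≤ η → dist x y ≤ D) :
    GromovHausdorff.ghDist X (ReebGraph r a b) ≤ (𝒯.betti1 + 1) * D := by
  have hD : 0 ≤ D := by
    have := hfib r r (by rw [dist_self]; exact hη.le)
    rwa [dist_self] at this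
  -- Half of the distortion `(2β₁ + 1) D` enters the bound, and this is at most `(β₁ + 1) D`.
  have h := GromovHausdorff.ghDist_le_of_approx_subsets (s := (univ : Set X)) (ε₁ := 0)
    (ε₂ := (2 * 𝒯.betti1 + 1) * D) (ε₃ := 0) (fun x => ReebGraph.proj r a b x.1)
    (fun x => ⟨x, mem_univ x, (dist_self x).le⟩)
    (fun p => by
      obtain ⟨x, rfl⟩ := ReebGraph.proj_surjective r a b p
      exact ⟨⟨x, mem_univ x⟩, (dist_self _).le⟩)
    (fun x y => by
      have h1 := dist_le_dist_add_betti1 (r := r) 𝒯 (ReebGraph.proj_surjective r a b)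
        ReebGraph.dist_proj_le ReebGraph.dist_proj_root hη hfib x.1 y.1
      have h2 := ReebGraph.dist_proj_le (r := r) (a := a) (b := b) x.1 y.1
      rw [Subtype.dist_eq, abs_of_nonneg (sub_nonneg.2 h2)]
      linarith)
  linarith

end Reconstruction

theorem MetricGraph.tendsto_reconstruction_bound {G : Type*} [MetricSpace G] (𝒢 : MetricGraph G)
    {M ε : ℝ} (hM : 0 ≤ M) (hε : 0 ≤ ε) (α c : ℝ) :
    Tendsto (fun R : ℝ => c * (4 * (2 + (𝒢.edgeCount (4 * (α + 4 * ε * M / R + 4 * ε)) : ℝ))) *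
        (α + 4 * ε * M / R + 4 * ε) + (4 * M / R + 2) * ε) atTop
      (𝓝 (c * (4 * (2 + 𝒢.edgeCount (4 * (α + 4 * ε)))) * (α + 4 * ε) + 2 * ε)) := by
  have h1 : Tendsto (fun R : ℝ => 4 * ε * M / R) atTop (𝓝 0) :=
    tendsto_const_nhds.div_atTop tendsto_id
  have h2 : Tendsto (fun R : ℝ => 4 * M / R) atTop (𝓝 0) :=
    tendsto_const_nhds.div_atTop tendsto_id
  have h3 : Tendsto (fun R : ℝ => α + 4 * ε * M / R + 4 * ε) atTop (𝓝 (α + 4 * ε)) := by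
    simpa using (tendsto_const_nhds.add h1).add_const (4 * ε)
  -- The threshold approaches its limit from above, the side on which the edge count is continuous.
  have h4 : Tendsto (fun R : ℝ => 4 * (α + 4 * ε * M / R + 4 * ε)) atTop
      (𝓝[≥] (4 * (α + 4 * ε))) := by
    refine tendsto_nhdsWithin_iff.2 ⟨h3.const_mul 4, ?_⟩
    filter_upwards [eventually_gt_atTop 0] with R hR
    have : 0 ≤ 4 * ε * M / R := by positivity
    rw [mem_Ici]
    linarith
  have h5 : Tendsto (fun R : ℝ => (𝒢.edgeCount (4 * (α + 4 * ε * M / R + 4 * ε)) : ℝ)) atTop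
      (𝓝 (𝒢.edgeCount (4 * (α + 4 * ε)))) := by
    refine tendsto_const_nhds.congr' ?_
    filter_upwards [h4.eventually (𝒢.eventually_edgeCount_eq _)] with R hR
    rw [hR]
  have h6 := (((h5.const_add 2).const_mul 4).const_mul c).mul h3
  have h7 : Tendsto (fun R : ℝ => (4 * M / R + 2) * ε) atTop (𝓝 (2 * ε)) := by
    simpa using (h2.add_const 2).mul_const ε
  exact h6.add h7

theorem theorem4p2 {G : Type*} [MetricSpace G] [CompactSpace G] (𝒢 : MetricGraph G)
    (M : ℝ) (hM : Metric.diam (Set.univ : Set G) = M)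
    {X : Type*} [MetricSpace X] [CompactSpace X] [Nonempty X] [GeodesicSpace X]
    (ε : ℝ) (hε : 0 < ε) (r : X) (α : ℝ) (hα : 0 < α)
    {ι : Type*} [Finite ι] (a b : ι → ℝ) (hlen : ∀ i, b i - a i ≤ α)
    (hcover : Set.Icc 0 (Metric.diam (Set.univ : Set X)) ⊆ ⋃ i, Set.Ioo (a i) (b i))
    (𝒯 : MetricGraph (ReebGraph r a b)) :
    (∀ R : ℝ, 0 < R → IsDeltaDense R X → IsLocalApprox ε R X G →
      GromovHausdorff.ghDist X (ReebGraph r a b) ≤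
        (𝒯.betti1 + 1) *
            (4 * (2 + 𝒢.edgeCount (4 * (α + 4 * ε * M / R + 4 * ε)))) *
            (α + 4 * ε * M / R + 4 * ε) + (4 * M / R + 2) * ε) ∧
    Filter.Tendsto
      (fun R : ℝ => ((𝒯.betti1 : ℝ) + 1) *
            (4 * (2 + 𝒢.edgeCount (4 * (α + 4 * ε * M / R + 4 * ε)))) *
            (α + 4 * ε * M / R + 4 * ε) + (4 * M / R + 2) * ε)
      Filter.atTop
      (nhds ((𝒯.betti1 + 1) * (4 * (2 + 𝒢.edgeCount (4 * (α + 4 * ε)))) *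
            (α + 4 * ε) + 2 * ε)) ∧
    ((∃ᶠ R : ℝ in Filter.atTop, IsDeltaDense R X ∧ IsLocalApprox ε R X G) →
      GromovHausdorff.ghDist X (ReebGraph r a b) ≤
        (𝒯.betti1 + 1) * (4 * (2 + 𝒢.edgeCount (4 * (α + 4 * ε)))) *
            (α + 4 * ε) + 2 * ε) := by
  have hM0 : 0 ≤ M := hM ▸ Metric.diam_nonneg
  have hbound : ∀ R : ℝ, 0 < R → IsDeltaDense R X → IsLocalApprox ε R X G →
      GromovHausdorff.ghDist X (ReebGraph r a b) ≤
        (𝒯.betti1 + 1) *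
            (4 * (2 + 𝒢.edgeCount (4 * (α + 4 * ε * M / R + 4 * ε)))) *
            (α + 4 * ε * M / R + 4 * ε) + (4 * M / R + 2) * ε := by
    intro R hR _ happ
    -- This is `δ / 8`, the closeness in the Reeb graph at which `dist_le_of_dist_proj_le` applies.
    -- The term `(4 * M / R + 2) * ε` of the claim is nonnegative slack.
    have hδ : 0 < ε * (M / R + 1) / 8 := by positivity
    have h := ghDist_reebGraph_le 𝒯 hδ fun x y hxy =>
      dist_le_of_dist_proj_le 𝒢 hε hR hα hlen happ (by rw [hM]) hxy
    have he : α + 4 * (ε * (M / R + 1)) = α + 4 * ε * M / R + 4 * ε := by ring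
    rw [he, ← mul_assoc] at h
    have : 0 ≤ (4 * M / R + 2) * ε := by positivity
    linarith
  have hlim := 𝒢.tendsto_reconstruction_bound hM0 hε.le α (𝒯.betti1 + 1)
  refine ⟨hbound, hlim, fun hfreq => ge_of_tendsto_of_frequently hlim ?_⟩
  refine (hfreq.and_eventually (eventually_gt_atTop 0)).mono fun R hR => ?_
  exact hbound R hR.2 hR.1.1 hR.1.2
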